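/- Fix a prime $p$ and integers $K,d,m,m'\ge 0$. A symmetric linear computation broadcast (LCBC) instance over a finite field $\mathbb{F}_q$ consists of matrices ${\bf v}_k\in\mathbb{F}_q^{d\times m}$ (demands) and ${\bf v}'_k\in\mathbb{F}_q^{d\times m'}$ (side-information), $k=1,\dots,K$. A coding scheme consists of a batch size $L\ge 1$, a finite alphabet $\mathcal{S}$, an encoder $\Phi:\mathbb{F}_q^{d\times L}\to\mathcal{S}$ and decoders $\Psi_k:\mathcal{S}\times\mathbb{F}_q^{L\times m'}\to\mathbb{F}_q^{L\times m}$, $k=1,\dots,K$ (arbitrary maps, not necessarily linear); it is achievable for the instance if $\Psi_k(\Phi({\bf x}),{\bf x}^T{\bf v}'_k)={\bf x}^T{\bf v}_k$ for all ${\bf x}\in\mathbb{F}_q^{d\times L}$ and all $k$, and its broadcast cost is $\log_q|\mathcal{S}|/L$. The optimal broadcast cost $\Delta^*(\Lambda)$ of an instance $\Lambda$ is the infimum of the broadcast costs of its achievable schemes. Let $\Lambda_n$ be uniformly distributed on the set of all instances over $\mathbb{F}_{p^n}$ with the given $K,d,m,m'$. The generic optimal broadcast cost is said to exist and to equal $\Delta_g\in\mathbb{R}$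 if $\Delta^*(\Lambda_n)\to\Delta_g$ in probability, i.e. $\lim_{n\to\infty}\Pr\big(|\Delta^*(\Lambda_n)-\Delta_g|<\varepsilon\big)=1$ for every $\varepsilon>0$. **Theorem.** Suppose $K\ge d/\gcd(d,m+m')$ (a condition that is read as vacuous when $d=0$). Then in each of the following cases the generic optimal broadcast cost exists, and $$\Delta_g=\begin{cases}0, & d\le m';\\ d-m', & m'\le d\le m+m';\\ \dfrac{dm}{m+m'}, & m+m'<d\le K(m+m').\end{cases}$$ -/

import Mathlib

open Filter Topology

namespace LCBC

/-- A symmetric linear computation broadcast instance over `F` with `K` users, `d`-dimensional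
data, `m`-dimensional demands and `m'`-dimensional side-information: the coefficient matrices
`v k` (demands) and `v' k` (side-information). No rank condition is imposed. -/
abbrev Inst (F : Type) (K d m m' : ℕ) : Type :=
  (Fin K → Matrix (Fin d) (Fin m) F) × (Fin K → Matrix (Fin d) (Fin m') F)

/-- The demand matrix of user `k`. -/
abbrev Inst.v {F : Type} {K d m m' : ℕ} (Λ : Inst F K d m m') (k : Fin K) :
    Matrix (Fin d) (Fin m) F := Λ.1 k

/-- The side-information matrix of user `k`. -/
abbrev Inst.v' {F : Type} {K d m m' : ℕ} (Λ : Inst F K d m m') (k : Fin K) :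
    Matrix (Fin d) (Fin m') F := Λ.2 k

/-- A coding scheme: a batch size `L ≥ 1`, a finite alphabet `S`, an arbitrary (not necessarily
linear) encoder of the `d × L` data matrix, and an arbitrary decoder for each user. -/
structure Scheme (F : Type) (K d m m' : ℕ) where
  L : ℕ
  L_pos : 0 < L
  S : Type
  finite_S : Finite S
  enc : Matrix (Fin d) (Fin L) F → S
  dec : Fin K → S → Matrix (Fin L) (Fin m') F → Matrix (Fin L) (Fin m) F

/-- The scheme lets every user `k` compute `xᵀ vₖ` from the broadcast symbol and its
side-information `xᵀ v'ₖ`, for every realization `x` of the data. -/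
def Scheme.Achieves {F : Type} [Field F] {K d m m' : ℕ} (σ : Scheme F K d m m')
    (Λ : Inst F K d m m') : Prop :=
  ∀ (x : Matrix (Fin d) (Fin σ.L) F) (k : Fin K),
    σ.dec k (σ.enc x) (x.transpose * Λ.v' k) = x.transpose * Λ.v k

/-- The broadcast cost `log_q |S| / L`, where `q = |F|`. -/
noncomputable def Scheme.cost {F : Type} {K d m m' : ℕ} (σ : Scheme F K d m m') : ℝ :=
  Real.logb (Nat.card F) (Nat.card σ.S) / σ.L

/-- The optimal broadcast cost `Δ*(Λ)`: the infimum of the costs of the achievable schemes. -/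
noncomputable def optCost {F : Type} [Field F] {K d m m' : ℕ} (Λ : Inst F K d m m') : ℝ :=
  sInf {Δ : ℝ | ∃ σ : Scheme F K d m m', σ.Achieves Λ ∧ σ.cost = Δ}

/-- The probability of the event `E` for an instance drawn uniformly at random among all
instances over the field with `p ^ n` elements. -/
noncomputable def prob (p : ℕ) [Fact p.Prime] (n K d m m' : ℕ)
    (E : Inst (GaloisField p n) K d m m' → Prop) : ℝ :=
  (Nat.card {Λ : Inst (GaloisField p n) K d m m' // E Λ} : ℝ) /
    (Nat.card (Inst (GaloisField p n) K d m m') : ℝ)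

/-- The generic optimal broadcast cost exists and equals `Δg`: as `n → ∞`, the optimal cost of a
uniformly random instance over the field with `p ^ n` elements converges to `Δg` in
probability. -/
def IsGenericCost (p : ℕ) [Fact p.Prime] (K d m m' : ℕ) (Δg : ℝ) : Prop :=
  ∀ ε : ℝ, 0 < ε →
    Tendsto (fun n : ℕ => prob p n K d m m' (fun Λ => |optCost Λ - Δg| < ε)) atTop (𝓝 1)

end LCBC

/-! Lower bounds. For uniform data `x` and a subspace `U` of `F^d`, let `f U` be the entropy of the
broadcast symbol together with `xᵀ U` (`obsEnt`). This `f` is submodular, `f ⊤ = d L log q`, `f ⊥ ≤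
log |S|`, and decodability gives `f U ≤ f ⊥ + m' L log q` when `U` is spanned by the demand and
side-information columns of one user. If such a `U` is everything, the cost is at least `d - m'`. If
`m + m' < d`, the user spaces are in general position with probability `1 - O(1/q)`. Uncrossing `N`
of them, where `N (m + m') = t d`, then gives `∑ f (U i) ≥ t f ⊤ + (N - t) f ⊥`
(`InGeneralPosition.sum_ge`), that is, a cost of at least `N m / t = d m / (m + m')`.

Upper bounds. Batch size 1 suffices. Broadcast an additive image `φ x` and, for each user, a residue
that resolves what `φ x` and the side-information leave open; if these ambiguity groups have at most
`q^δ` elements, the surcharge is at most `K δ` (`optCost_le_of_ambiguity`). A first-moment bound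
shows that they are that small with high probability. For `d ≤ m + m'`, `φ` keeps the first `d - m'`
coordinates (none if `d ≤ m'`).

For `d > m + m'`, `φ` reduces every coordinate modulo an `F_p`-subspace `Z` of `F`. Every entry of
the instance maps `Z` into a space `Z₀`, and both spaces have codimension about `m n / (m + m')`
(`exists_aligned`). They arise by trace duality from disjoint translates of a span of monomials in
the entries, which hardly grows under multiplication by an entry. An ambiguous demand `y` then lies
in `Z₀^m`. To exploit the side-information, replace `v'` by `v' + v P` with `P` uniform; now `y P`
lies in `Z₀^m'` as well, and the expected number of such `y` is bounded independently of `n`. The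
shear is a bijection on instances for each `P`, so the sheared instance, from which `Z₀` is built,
may be treated as independent of `P` (`pr_le_of_forall`). -/

namespace LCBC

/-! ### Entropy of partitions of a finite set -/

section Entropy

open Classical in
/-- The number of elements of the class of `ω`. -/
noncomputable def classCard {Ω : Type*} [Fintype Ω] (r : Setoid Ω) (ω : Ω) : ℕ :=
  (Finset.univ.filter fun y => r y ω).card

/-- The entropy of the class of a uniformly distributed point of `Ω`. -/
noncomputable def ent {Ω : Type*} [Fintype Ω] (r : Setoid Ω) : ℝ :=
  Real.log (Fintype.card Ω) - (∑ ω, Real.log (classCard r ω)) / Fintype.card Ω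

variable {Ω : Type*} [Fintype Ω]

lemma classCard_pos (r : Setoid Ω) (ω : Ω) : 0 < classCard r ω := by
  classical
  exact Finset.card_pos.mpr ⟨ω, by simp⟩

lemma classCard_congr (r : Setoid Ω) {a b : Ω} (h : r a b) : classCard r a = classCard r b := by
  classical
  unfold classCard
  congr 1
  ext y
  simp only [Finset.mem_filter, Finset.mem_univ, true_and]
  exact ⟨fun hy => r.trans hy h, fun hy => r.trans hy (r.symm h)⟩

/-- Write the numerator as a count of pairs `(a, b)` with `a` in the `r`-class and `b` in the
`s`-class of `ω`, and exchange the sums. For fixed `a`, `b` the admissible `ω` are either none or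
exactly one class of `r ⊓ s`, which cancels that denominator. What remains is `1 / classCard t a`,
for `b` in the `t`-class of `a`. -/
lemma classCard_ratio_sum_le {r s t : Setoid Ω} (hr : r ≤ t) (hs : s ≤ t) :
    ∑ ω, (classCard r ω * classCard s ω : ℝ) / (classCard (r ⊓ s) ω * classCard t ω) ≤
      Fintype.card Ω := by
  classical
  have expand : ∀ ω, (classCard r ω * classCard s ω : ℝ) /
      (classCard (r ⊓ s) ω * classCard t ω) =
      ∑ a, ∑ b, if r a ω ∧ s b ω then
        1 / (classCard (r ⊓ s) ω * classCard t ω : ℝ) else 0 := by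
    intro ω
    have h : (classCard r ω * classCard s ω : ℝ) =
        ∑ a, ∑ b, (if r a ω then (1 : ℝ) else 0) * (if s b ω then 1 else 0) := by
      rw [← Finset.sum_mul_sum]
      simp [classCard]
    rw [h, Finset.sum_div]
    refine Finset.sum_congr rfl fun a _ => ?_
    rw [Finset.sum_div]
    refine Finset.sum_congr rfl fun b _ => ?_
    by_cases h1 : r a ω <;> by_cases h2 : s b ω <;> simp [h1, h2]
  have inner : ∀ a b, (∑ ω, if r a ω ∧ s b ω then
      1 / (classCard (r ⊓ s) ω * classCard t ω : ℝ) else 0) ≤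
      if t b a then 1 / (classCard t a : ℝ) else 0 := by
    intro a b
    by_cases hex : ∃ ω₀, r a ω₀ ∧ s b ω₀
    · obtain ⟨ω₀, h1, h2⟩ := hex
      have hta : t a ω₀ := hr h1
      have htb : t b ω₀ := hs h2
      rw [if_pos (t.trans htb (t.symm hta))]
      have hiff : ∀ ω, (r a ω ∧ s b ω) ↔ (r ⊓ s) ω ω₀ := by
        intro ω
        constructor
        · rintro ⟨h3, h4⟩
          exact ⟨r.trans (r.symm h3) h1, s.trans (s.symm h4) h2⟩
        · rintro ⟨h3, h4⟩
          exact ⟨r.trans h1 (r.symm h3), s.trans h2 (s.symm h4)⟩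
      have : ∀ ω, (if r a ω ∧ s b ω then
          1 / (classCard (r ⊓ s) ω * classCard t ω : ℝ) else 0) =
          if (r ⊓ s) ω ω₀ then 1 / (classCard (r ⊓ s) ω₀ * classCard t a : ℝ) else 0 := by
        intro ω
        by_cases h : (r ⊓ s) ω ω₀
        · rw [if_pos h, if_pos ((hiff ω).mpr h), classCard_congr _ h,
            classCard_congr t (t.trans (t.symm (hr ((hiff ω).mpr h).1)) (t.refl a))]
        · rw [if_neg h, if_neg (fun h' => h ((hiff ω).mp h'))]
      rw [Finset.sum_congr rfl fun ω _ => this ω, ← Finset.sum_filter, Finset.sum_const,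
        nsmul_eq_mul]
      have hpos : (0 : ℝ) < classCard (r ⊓ s) ω₀ := by exact_mod_cast classCard_pos _ _
      have hpos' : (0 : ℝ) < classCard t a := by exact_mod_cast classCard_pos _ _
      have : ((Finset.univ.filter fun ω => (r ⊓ s) ω ω₀).card : ℝ) = classCard (r ⊓ s) ω₀ := by
        simp [classCard]
      rw [this]
      field_simp
      exact le_refl _
    · have : ∀ ω, (if r a ω ∧ s b ω then
          1 / (classCard (r ⊓ s) ω * classCard t ω : ℝ) else 0) = 0 :=
        fun ω => if_neg fun h => hex ⟨ω, h⟩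
      rw [Finset.sum_congr rfl fun ω _ => this ω, Finset.sum_const_zero]
      split_ifs <;> positivity
  calc _ = ∑ a, ∑ b, ∑ ω, (if r a ω ∧ s b ω then
        1 / (classCard (r ⊓ s) ω * classCard t ω : ℝ) else 0) := by
        rw [Finset.sum_congr rfl fun ω _ => expand ω, Finset.sum_comm]
        exact Finset.sum_congr rfl fun a _ => Finset.sum_comm
    _ ≤ ∑ a, ∑ b, if t b a then 1 / (classCard t a : ℝ) else 0 :=
        Finset.sum_le_sum fun a _ => Finset.sum_le_sum fun b _ => inner a b
    _ = ∑ _a : Ω, (1 : ℝ) := by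
        refine Finset.sum_congr rfl fun a _ => ?_
        rw [← Finset.sum_filter, Finset.sum_const, nsmul_eq_mul]
        have hpos' : (0 : ℝ) < classCard t a := by exact_mod_cast classCard_pos _ _
        change (classCard t a : ℝ) * _ = 1
        field_simp
    _ = Fintype.card Ω := by simp

/-- Submodularity of entropy. -/
lemma ent_inf_add_le [Nonempty Ω] {r s t : Setoid Ω} (hr : r ≤ t) (hs : s ≤ t) :
    ent (r ⊓ s) + ent t ≤ ent r + ent s := by
  have hpos : ∀ (u : Setoid Ω) ω, (0 : ℝ) < classCard u ω :=
    fun u ω => by exact_mod_cast classCard_pos u ω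
  -- `log x ≤ x - 1` at the ratio of class sizes; by `classCard_ratio_sum_le` the right-hand sides
  -- sum to at most `0`.
  have h1 : ∀ ω, Real.log (classCard r ω) + Real.log (classCard s ω) -
      (Real.log (classCard (r ⊓ s) ω) + Real.log (classCard t ω)) ≤
      (classCard r ω * classCard s ω : ℝ) / (classCard (r ⊓ s) ω * classCard t ω) - 1 := by
    intro ω
    rw [← Real.log_mul (hpos _ _).ne' (hpos _ _).ne', ← Real.log_mul (hpos _ _).ne' (hpos _ _).ne',
      ← Real.log_div (mul_pos (hpos _ _) (hpos _ _)).ne' (mul_pos (hpos _ _) (hpos _ _)).ne']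
    exact Real.log_le_sub_one_of_pos
      (div_pos (mul_pos (hpos _ _) (hpos _ _)) (mul_pos (hpos _ _) (hpos _ _)))
  have h2 := Finset.sum_le_sum fun ω (_ : ω ∈ Finset.univ) => h1 ω
  simp only [Finset.sum_sub_distrib, Finset.sum_add_distrib] at h2
  have h3 := classCard_ratio_sum_le hr hs
  simp only [Finset.sum_const, Finset.card_univ, nsmul_eq_mul, mul_one] at h2
  have hc : (0 : ℝ) < Fintype.card Ω := by exact_mod_cast Fintype.card_pos
  have h4 : (∑ ω, Real.log (classCard r ω)) / Fintype.card Ω +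
      (∑ ω, Real.log (classCard s ω)) / Fintype.card Ω ≤
      (∑ ω, Real.log (classCard (r ⊓ s) ω)) / Fintype.card Ω +
      (∑ ω, Real.log (classCard t ω)) / Fintype.card Ω := by
    rw [← add_div, ← add_div]
    exact div_le_div_of_nonneg_right (by linarith) hc.le
  unfold ent
  linarith

lemma ent_top [Nonempty Ω] : ent (⊤ : Setoid Ω) = 0 := by
  classical
  have hc : (Fintype.card Ω : ℝ) ≠ 0 := by exact_mod_cast Fintype.card_ne_zero
  have : ∀ ω, classCard (⊤ : Setoid Ω) ω = Fintype.card Ω := by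
    intro ω
    simp [classCard, Setoid.top_def]
  simp only [ent, this, Finset.sum_const, Finset.card_univ, nsmul_eq_mul]
  field_simp
  simp

lemma ent_bot : ent (⊥ : Setoid Ω) = Real.log (Fintype.card Ω) := by
  classical
  have : ∀ ω, classCard (⊥ : Setoid Ω) ω = 1 := by
    intro ω
    rw [classCard, Finset.card_eq_one]
    refine ⟨ω, ?_⟩
    ext y
    simp
  simp [ent, this]

/-- The entropy of a function is at most the logarithm of the size of its codomain. -/
lemma ent_ker_le [Nonempty Ω] {β : Type*} [Fintype β] (g : Ω → β) :
    ent (Setoid.ker g) ≤ Real.log (Fintype.card β) := by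
  classical
  have hc : (0 : ℝ) < Fintype.card Ω := by exact_mod_cast Fintype.card_pos
  have : Nonempty β := ‹Nonempty Ω›.map g
  have hb : (0 : ℝ) < Fintype.card β := by exact_mod_cast Fintype.card_pos
  have hpos : ∀ ω, (0 : ℝ) < classCard (Setoid.ker g) ω :=
    fun ω => by exact_mod_cast classCard_pos _ ω
  -- Every nonempty fibre contributes exactly `1`.
  have hsum : ∑ ω, 1 / (classCard (Setoid.ker g) ω : ℝ) ≤ Fintype.card β := by
    rw [← Finset.sum_fiberwise Finset.univ g]
    calc _ ≤ ∑ _b : β, (1 : ℝ) := by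
          refine Finset.sum_le_sum fun b _ => ?_
          have : ∀ ω ∈ Finset.univ.filter (fun ω => g ω = b),
              1 / (classCard (Setoid.ker g) ω : ℝ) =
              1 / ((Finset.univ.filter (fun ω => g ω = b)).card : ℝ) := by
            intro ω hω
            simp only [Finset.mem_filter, Finset.mem_univ, true_and] at hω
            subst hω
            rfl
          rw [Finset.sum_congr rfl this, Finset.sum_const, nsmul_eq_mul, mul_one_div]
          exact div_self_le_one _
      _ = _ := by simp
  have h1 : ∀ ω, Real.log (Fintype.card Ω) - Real.log (Fintype.card β) -
      Real.log (classCard (Setoid.ker g) ω) ≤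
      (Fintype.card Ω / Fintype.card β : ℝ) * (1 / classCard (Setoid.ker g) ω) - 1 := by
    intro ω
    rw [← Real.log_div hc.ne' hb.ne', ← Real.log_div (div_pos hc hb).ne' (hpos ω).ne',
      ← div_eq_mul_one_div]
    exact Real.log_le_sub_one_of_pos (div_pos (div_pos hc hb) (hpos ω))
  have h2 := Finset.sum_le_sum fun ω (_ : ω ∈ Finset.univ) => h1 ω
  simp only [Finset.sum_sub_distrib, ← Finset.mul_sum, Finset.sum_const, Finset.card_univ,
    nsmul_eq_mul, mul_one] at h2
  have h3 : (Fintype.card Ω / Fintype.card β : ℝ) *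
      ∑ ω, 1 / (classCard (Setoid.ker g) ω : ℝ) ≤ Fintype.card Ω := by
    calc _ ≤ (Fintype.card Ω / Fintype.card β : ℝ) * Fintype.card β :=
          mul_le_mul_of_nonneg_left hsum (div_pos hc hb).le
      _ = _ := by field_simp
  have h4 : Real.log (Fintype.card Ω) - Real.log (Fintype.card β) ≤
      (∑ ω, Real.log (classCard (Setoid.ker g) ω)) / Fintype.card Ω := by
    rw [le_div_iff₀ hc]
    nlinarith
  unfold ent
  linarith

/-- Subadditivity of entropy, with the entropy of the second part bounded by its range. -/
lemma ent_inf_ker_le [Nonempty Ω] {β : Type*} [Fintype β] (r : Setoid Ω) (g : Ω → β) :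
    ent (r ⊓ Setoid.ker g) ≤ ent r + Real.log (Fintype.card β) := by
  have h1 := ent_inf_add_le (le_top : r ≤ ⊤) (le_top : Setoid.ker g ≤ ⊤)
  have h2 := ent_ker_le g
  rw [ent_top] at h1
  linarith

end Entropy

/-! ### Entropy of the broadcast seen together with a subspace of functionals -/

section Converse

variable {F : Type} [Field F] {K d m m' : ℕ}

lemma log_card_matrix (F : Type*) [Fintype F] (a b : ℕ) :
    Real.log (Fintype.card (Matrix (Fin a) (Fin b) F)) =
      a * b * Real.log (Fintype.card F) := by
  rw [Fintype.card_congr (Matrix.of (m := Fin a) (n := Fin b) (α := F)).symm]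
  simp
  ring

/-- Two data matrices are related if they have the same encoding and the same image under every
functional in `U`. -/
def obsRel {S : Type*} {L : ℕ} (enc : Matrix (Fin d) (Fin L) F → S)
    (U : Submodule F (Fin d → F)) : Setoid (Matrix (Fin d) (Fin L) F) :=
  Setoid.ker enc ⊓ Setoid.ker fun x (u : U) => x.transpose.mulVec u.1

lemma obsRel_iff {S : Type*} {L : ℕ} {enc : Matrix (Fin d) (Fin L) F → S}
    {U : Submodule F (Fin d → F)} {x y : Matrix (Fin d) (Fin L) F} :
    obsRel enc U x y ↔
      enc x = enc y ∧ ∀ u ∈ U, x.transpose.mulVec u = y.transpose.mulVec u := by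
  constructor
  · rintro ⟨h1, h2⟩
    exact ⟨h1, fun u hu => congrFun h2 ⟨u, hu⟩⟩
  · rintro ⟨h1, h2⟩
    exact ⟨h1, funext fun u => h2 u.1 u.2⟩

lemma obsRel_anti {S : Type*} {L : ℕ} (enc : Matrix (Fin d) (Fin L) F → S)
    {A B : Submodule F (Fin d → F)} (h : A ≤ B) : obsRel enc B ≤ obsRel enc A := by
  intro x y hxy
  rw [obsRel_iff] at hxy ⊢
  exact ⟨hxy.1, fun u hu => hxy.2 u (h hu)⟩

lemma obsRel_sup {S : Type*} {L : ℕ} (enc : Matrix (Fin d) (Fin L) F → S)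
    (A B : Submodule F (Fin d → F)) : obsRel enc (A ⊔ B) = obsRel enc A ⊓ obsRel enc B := by
  refine le_antisymm (le_inf (obsRel_anti enc le_sup_left) (obsRel_anti enc le_sup_right)) ?_
  rintro x y ⟨hA, hB⟩
  change obsRel enc A x y at hA
  change obsRel enc B x y at hB
  rw [obsRel_iff] at hA hB ⊢
  refine ⟨hA.1, fun u hu => ?_⟩
  obtain ⟨a, ha, b, hb, rfl⟩ := Submodule.mem_sup.mp hu
  rw [Matrix.mulVec_add, Matrix.mulVec_add, hA.2 a ha, hB.2 b hb]

lemma obsRel_bot {S : Type*} {L : ℕ} (enc : Matrix (Fin d) (Fin L) F → S) :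
    obsRel enc (⊥ : Submodule F (Fin d → F)) = Setoid.ker enc := by
  ext x y
  rw [obsRel_iff, Setoid.ker_def]
  simp

lemma obsRel_top {S : Type*} {L : ℕ} (enc : Matrix (Fin d) (Fin L) F → S) :
    obsRel enc (⊤ : Submodule F (Fin d → F)) = ⊥ := by
  rw [eq_bot_iff]
  intro x y h
  rw [obsRel_iff] at h
  have h2 : x.transpose = y.transpose :=
    Matrix.ext_of_mulVec_single fun i => h.2 _ Submodule.mem_top
  change x = y
  exact Matrix.transpose_injective h2

/-- The entropy of the encoding and of the data seen through the functionals in `U`. -/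
noncomputable def obsEnt [Fintype F] {S : Type*} {L : ℕ} (enc : Matrix (Fin d) (Fin L) F → S)
    (U : Submodule F (Fin d → F)) : ℝ :=
  ent (obsRel enc U)

lemma obsEnt_submodular [Fintype F] {S : Type*} {L : ℕ} (enc : Matrix (Fin d) (Fin L) F → S)
    (A B : Submodule F (Fin d → F)) :
    obsEnt enc (A ⊔ B) + obsEnt enc (A ⊓ B) ≤ obsEnt enc A + obsEnt enc B := by
  unfold obsEnt
  rw [obsRel_sup]
  exact ent_inf_add_le (obsRel_anti enc inf_le_left) (obsRel_anti enc inf_le_right)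

lemma obsEnt_top [Fintype F] {S : Type*} {L : ℕ} (enc : Matrix (Fin d) (Fin L) F → S) :
    obsEnt enc ⊤ = d * L * Real.log (Fintype.card F) := by
  unfold obsEnt
  rw [obsRel_top, ent_bot, log_card_matrix]

lemma obsEnt_bot_le [Fintype F] {S : Type*} [Fintype S] {L : ℕ}
    (enc : Matrix (Fin d) (Fin L) F → S) :
    obsEnt enc ⊥ ≤ Real.log (Fintype.card S) := by
  unfold obsEnt
  rw [obsRel_bot]
  exact ent_ker_le enc

/-- The space spanned by the demands and the side-information of user `k`. -/
def userSpace (Λ : Inst F K d m m') (k : Fin K) : Submodule F (Fin d → F) :=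
  LinearMap.range (Matrix.fromCols (Λ.v k) (Λ.v' k)).mulVecLin

/-- The broadcast and the side-information determine the demand, so adjoining all of the user space
costs no more entropy than adjoining the side-information, which takes `q^(m' L)` values. -/
lemma obsEnt_userSpace_le [Fintype F] {σ : Scheme F K d m m'} {Λ : Inst F K d m m'}
    (h : σ.Achieves Λ) (k : Fin K) :
    obsEnt σ.enc (userSpace Λ k) ≤
      obsEnt σ.enc ⊥ + m' * σ.L * Real.log (Fintype.card F) := by
  have key : obsRel σ.enc (userSpace Λ k) =
      Setoid.ker σ.enc ⊓ Setoid.ker fun x => x.transpose * Λ.v' k := by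
    ext x y
    rw [obsRel_iff]
    constructor
    · rintro ⟨h1, h2⟩
      refine ⟨h1, ?_⟩
      change x.transpose * Λ.v' k = y.transpose * Λ.v' k
      refine Matrix.ext_of_mulVec_single fun j => ?_
      rw [← Matrix.mulVec_mulVec, ← Matrix.mulVec_mulVec]
      refine h2 _ ⟨Sum.elim 0 (Pi.single j 1), ?_⟩
      rw [Matrix.mulVecLin_apply, Matrix.fromCols_mulVec, Sum.elim_comp_inl, Sum.elim_comp_inr,
        Matrix.mulVec_zero, zero_add]
    · rintro ⟨h1, h2⟩
      change σ.enc x = σ.enc y at h1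
      change x.transpose * Λ.v' k = y.transpose * Λ.v' k at h2
      have h3 : x.transpose * Λ.v k = y.transpose * Λ.v k := by
        rw [← h x k, ← h y k, h1, h2]
      refine ⟨h1, ?_⟩
      rintro _ ⟨c, rfl⟩
      rw [Matrix.mulVecLin_apply, Matrix.fromCols_mulVec, Matrix.mulVec_add, Matrix.mulVec_add]
      simp only [Matrix.mulVec_mulVec, h2, h3]
  unfold obsEnt
  rw [key, obsRel_bot]
  refine (ent_inf_ker_le _ _).trans ?_
  rw [log_card_matrix, mul_comm (σ.L : ℝ)]

end Converse

/-! ### Uncrossing subspaces in general position -/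

section GenericPosition

open Classical in
/-- The running space of the uncrossing procedure applied to a sequence of subspaces. -/
noncomputable def uncross {F V : Type*} [Field F] [AddCommGroup V] [Module F V]
    (U : ℕ → Submodule F V) : ℕ → Submodule F V
  | 0 => ⊥
  | k + 1 => if uncross U k ⊓ U k = ⊥ then uncross U k ⊔ U k else uncross U k ⊓ U k

variable {F V : Type*} [Field F] [AddCommGroup V] [Module F V]

lemma uncross_congr {U U' : ℕ → Submodule F V} {k : ℕ} (h : ∀ i < k, U i = U' i) :
    uncross U k = uncross U' k := by
  induction k with
  | zero => rfl
  | succ k ih =>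
    simp only [uncross]
    rw [ih fun i hi => h i (by omega), h k (by omega)]

/-- Each of the first `N` subspaces has dimension `s`, and meets the running space trivially or
spans with it the whole space. -/
def InGeneralPosition (U : ℕ → Submodule F V) (s N : ℕ) : Prop :=
  ∀ i < N, Module.finrank F (U i) = s ∧
    (uncross U i ⊓ U i = ⊥ ∨ uncross U i ⊔ U i = ⊤)

/-- `j` counts the steps at which the running space is replaced by an intersection; the sum is then
the whole space. Each step applies submodularity once and splits off `f ⊤` in such a step, `f ⊥`
otherwise. The dimension formula keeps account of the total dimension. -/
lemma InGeneralPosition.uncross_le [FiniteDimensional F V] {U : ℕ → Submodule F V} {s N : ℕ}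
    (hU : InGeneralPosition U s N) {f : Submodule F V → ℝ}
    (hf : ∀ A B, f (A ⊔ B) + f (A ⊓ B) ≤ f A + f B) {k : ℕ} (hk : k ≤ N) :
    ∃ j : ℕ, k * s = j * Module.finrank F V + Module.finrank F (uncross U k) ∧
      j * f ⊤ + f (uncross U k) + k * f ⊥ ≤ ∑ i ∈ Finset.range k, f (U i) + f ⊥ + j * f ⊥ := by
  induction k with
  | zero => exact ⟨0, by rw [uncross, finrank_bot]; simp, by simp [uncross]⟩
  | succ k ih =>
    obtain ⟨j, h1, h2⟩ := ih (by omega)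
    obtain ⟨hs, hpos⟩ := hU k (by omega)
    have hdim := Submodule.finrank_sup_add_finrank_inf_eq (uncross U k) (U k)
    have hsub := hf (uncross U k) (U k)
    rw [Finset.sum_range_succ]
    by_cases hb : uncross U k ⊓ U k = ⊥
    · refine ⟨j, ?_, ?_⟩
      · rw [uncross, if_pos hb]
        rw [hb, finrank_bot] at hdim
        linarith
      · rw [uncross, if_pos hb]
        rw [hb] at hsub
        push_cast
        linarith
    · have ht := hpos.resolve_left hb
      refine ⟨j + 1, ?_, ?_⟩
      · rw [uncross, if_neg hb]
        rw [ht, finrank_top] at hdim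
        linarith
      · rw [uncross, if_neg hb]
        rw [ht] at hsub
        push_cast
        linarith

/-- A Shearer-type inequality for subspaces in general position. -/
lemma InGeneralPosition.sum_ge [FiniteDimensional F V] {U : ℕ → Submodule F V} {s N t : ℕ}
    (hU : InGeneralPosition U s N) (hN : N * s = t * Module.finrank F V)
    (hV : 0 < Module.finrank F V) {f : Submodule F V → ℝ}
    (hf : ∀ A B, f (A ⊔ B) + f (A ⊓ B) ≤ f A + f B) :
    t * f ⊤ + N * f ⊥ ≤ ∑ i ∈ Finset.range N, f (U i) + t * f ⊥ := by
  obtain ⟨j, h1, h2⟩ := hU.uncross_le hf le_rfl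
  have hle := Submodule.finrank_le (uncross U N)
  rw [hN] at h1
  -- Since `t d = j d + dim` with `0 ≤ dim ≤ d`, the final running space is `⊥` with `j = t`, or `⊤`
  -- with `j + 1 = t`.
  have hjt : j ≤ t := by
    by_contra hlt
    have := Nat.mul_le_mul_right (Module.finrank F V) (show t + 1 ≤ j by omega)
    nlinarith
  have htj : t ≤ j + 1 := by
    by_contra hlt
    have := Nat.mul_le_mul_right (Module.finrank F V) (show j + 2 ≤ t by omega)
    nlinarith
  obtain rfl | rfl : j = t ∨ t = j + 1 := by omega
  · have : Module.finrank F (uncross U N) = 0 := by omega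
    rw [Submodule.finrank_eq_zero] at this
    rw [this] at h2
    linarith
  · have : Module.finrank F (uncross U N) = Module.finrank F V := by linarith
    have := Submodule.eq_top_of_finrank_eq this
    rw [this] at h2
    push_cast
    linarith

end GenericPosition

/-! ### Lower bounds on the cost of a scheme -/

section ConverseBounds

variable {F : Type} [Field F] {K d m m' : ℕ}

/-- The spaces of the users as a sequence, extended by `⊥`. -/
def userSpaceSeq (Λ : Inst F K d m m') (i : ℕ) : Submodule F (Fin d → F) :=
  if h : i < K then userSpace Λ ⟨i, h⟩ else ⊥

lemma Scheme.log_card_eq [Finite F] (σ : Scheme F K d m m') :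
    Real.log (Nat.card σ.S) = σ.cost * σ.L * Real.log (Nat.card F) := by
  have hL : (σ.L : ℝ) ≠ 0 := by exact_mod_cast σ.L_pos.ne'
  have hq : Real.log (Nat.card F) ≠ 0 :=
    (Real.log_pos (by exact_mod_cast Finite.one_lt_card)).ne'
  rw [Scheme.cost, Real.logb]
  field_simp

/-- If the users are in general position, no scheme costs less than `d m / (m + m')`. -/
lemma Scheme.le_cost_of_inGeneralPosition [Finite F] {σ : Scheme F K d m m'}
    {Λ : Inst F K d m m'} (h : σ.Achieves Λ) {N t : ℕ} (hNK : N ≤ K) (hd : 0 < d) (ht : 0 < t)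
    (hN : N * (m + m') = t * d) (hg : InGeneralPosition (userSpaceSeq Λ) (m + m') N) :
    (N : ℝ) * m / t ≤ σ.cost := by
  have := Fintype.ofFinite F
  have := σ.finite_S
  have := Fintype.ofFinite σ.S
  have h1 := hg.sum_ge (f := obsEnt σ.enc) (t := t) (by simpa using hN) (by simpa using hd)
    (obsEnt_submodular σ.enc)
  have h2 : ∑ i ∈ Finset.range N, obsEnt σ.enc (userSpaceSeq Λ i) ≤
      N * (obsEnt σ.enc ⊥ + m' * σ.L * Real.log (Fintype.card F)) := by
    rw [← nsmul_eq_mul]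
    conv_rhs => rw [← Finset.card_range N]
    refine Finset.sum_le_card_nsmul _ _ _ fun i hi => ?_
    have hi' : i < K := lt_of_lt_of_le (Finset.mem_range.mp hi) hNK
    rw [userSpaceSeq, dif_pos hi']
    exact obsEnt_userSpace_le h _
  have h3 := obsEnt_bot_le σ.enc
  have h4 := σ.log_card_eq
  rw [obsEnt_top] at h1
  rw [← Nat.card_eq_fintype_card] at h1 h2 h3
  have hL : (0 : ℝ) < σ.L := by exact_mod_cast σ.L_pos
  have hq : 0 < Real.log (Nat.card F) := Real.log_pos (by exact_mod_cast Finite.one_lt_card)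
  have ht' : (0 : ℝ) < t := by exact_mod_cast ht
  have hN' : (N : ℝ) * (m + m') = t * d := by exact_mod_cast hN
  rw [div_le_iff₀ ht']
  -- With `H = obsEnt σ.enc ⊥`, the `N H` terms cancel and leave `t H ≥ (t d - N m') L log q = N m L
  -- log q`.
  refine le_of_mul_le_mul_right ?_ (mul_pos hL hq)
  have h5 : (t : ℝ) * obsEnt σ.enc ⊥ ≤ t * (σ.cost * σ.L * Real.log (Nat.card F)) :=
    mul_le_mul_of_nonneg_left (h3.trans (h4 ▸ le_of_eq (by simp))) ht'.le
  have h6 : (t : ℝ) * (d * σ.L * Real.log (Nat.card F)) =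
      (N : ℝ) * (m + m') * (σ.L * Real.log (Nat.card F)) := by
    rw [hN']; ring
  nlinarith

/-- If the space of some user is everything, no scheme costs less than `d - m'`. -/
lemma Scheme.le_cost_of_userSpace_eq_top [Finite F] {σ : Scheme F K d m m'}
    {Λ : Inst F K d m m'} (h : σ.Achieves Λ) {k : Fin K} (hk : userSpace Λ k = ⊤) :
    (d : ℝ) - m' ≤ σ.cost := by
  have := Fintype.ofFinite F
  have := σ.finite_S
  have := Fintype.ofFinite σ.S
  have h2 := obsEnt_userSpace_le h k
  have h3 := obsEnt_bot_le σ.enc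
  have h4 := σ.log_card_eq
  rw [hk, obsEnt_top] at h2
  rw [← Nat.card_eq_fintype_card] at h2 h3
  have hL : (0 : ℝ) < σ.L := by exact_mod_cast σ.L_pos
  have hq : 0 < Real.log (Nat.card F) := Real.log_pos (by exact_mod_cast Finite.one_lt_card)
  refine le_of_mul_le_mul_right ?_ (mul_pos hL hq)
  nlinarith

lemma Scheme.cost_nonneg [Finite F] (σ : Scheme F K d m m') : 0 ≤ σ.cost := by
  have := σ.finite_S
  have : Nonempty σ.S := ⟨σ.enc 0⟩
  refine div_nonneg (Real.logb_nonneg ?_ ?_) (Nat.cast_nonneg _)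
  · exact_mod_cast Finite.one_lt_card
  · exact_mod_cast Nat.card_pos

lemma optCost_le [Finite F] {σ : Scheme F K d m m'} {Λ : Inst F K d m m'} (h : σ.Achieves Λ) :
    optCost Λ ≤ σ.cost :=
  csInf_le ⟨0, by rintro _ ⟨τ, -, rfl⟩; exact τ.cost_nonneg⟩ ⟨σ, h, rfl⟩

end ConverseBounds

/-! ### Schemes that send an additive image and coset residues -/

section Achievability

/-- A map to a subgroup that is injective on each of its cosets. -/
noncomputable def cosetResidue {G : Type*} [AddCommGroup G] (H : AddSubgroup G) (g : G) : H :=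
  ⟨-(QuotientAddGroup.mk (s := H) g).out + g,
    QuotientAddGroup.eq.mp (QuotientAddGroup.out_eq' _)⟩

lemma cosetResidue_inj {G : Type*} [AddCommGroup G] {H : AddSubgroup G} {a b : G}
    (hab : a - b ∈ H) (h : cosetResidue H a = cosetResidue H b) : a = b := by
  have h1 : (QuotientAddGroup.mk (s := H) a) = QuotientAddGroup.mk b := by
    rw [QuotientAddGroup.eq_iff_sub_mem]
    exact hab
  have h2 := congrArg Subtype.val h
  simp only [cosetResidue, h1] at h2
  exact add_left_cancel h2

variable {F : Type} [Field F] {K d m m' : ℕ}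

/-- What user `k` cannot resolve of its demand, given `φ` of the data and its side-information. -/
def ambiguity {S : Type} [AddCommGroup S] (φ : (Fin d → F) →+ S) (Λ : Inst F K d m m')
    (k : Fin K) : AddSubgroup (Fin m → F) :=
  (φ.ker ⊓ (Matrix.vecMulLinear (Λ.v' k)).toAddMonoidHom.ker).map
    (Matrix.vecMulLinear (Λ.v k)).toAddMonoidHom

lemma mem_ambiguity {S : Type} [AddCommGroup S] {φ : (Fin d → F) →+ S} {Λ : Inst F K d m m'}
    {k : Fin K} {y : Fin m → F} :
    y ∈ ambiguity φ Λ k ↔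
      ∃ x, φ x = 0 ∧ Matrix.vecMul x (Λ.v' k) = 0 ∧ Matrix.vecMul x (Λ.v k) = y := by
  simp [ambiguity, AddSubgroup.mem_map, AddMonoidHom.mem_ker, and_assoc]

/-- The broadcast of `φ` of the data, together with the part of each demand that `φ` and the
side-information leave open. -/
noncomputable def residueScheme [Finite F] {S : Type} [AddCommGroup S] [Finite S]
    (φ : (Fin d → F) →+ S) (Λ : Inst F K d m m') : Scheme F K d m m' :=
  let enc : Matrix (Fin d) (Fin 1) F → S × (∀ k, ambiguity φ Λ k) := fun x =>
    (φ (x.col 0), fun k => cosetResidue (ambiguity φ Λ k) (Matrix.vecMul (x.col 0) (Λ.v k)))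
  { L := 1
    L_pos := one_pos
    S := S × (∀ k, ambiguity φ Λ k)
    finite_S := inferInstance
    enc := enc
    -- The default value `0` is taken only at pairs that no data produces.
    dec := fun k c y => Function.extend
      (fun x : Matrix (Fin d) (Fin 1) F => (enc x, x.transpose * Λ.v' k))
      (fun x => x.transpose * Λ.v k) 0 (c, y) }

/-- If two data vectors agree in broadcast and side-information, their difference is killed by `φ`
and by `v' k`, so their demands differ by an element of the ambiguity group. Equal residues within
one coset force equality. -/
lemma residueScheme_achieves [Finite F] {S : Type} [AddCommGroup S] [Finite S]
    (φ : (Fin d → F) →+ S) (Λ : Inst F K d m m') : (residueScheme φ Λ).Achieves Λ := by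
  intro x k
  refine Function.FactorsThrough.extend_apply
    (f := fun x : Matrix (Fin d) (Fin 1) F => ((residueScheme φ Λ).enc x, x.transpose * Λ.v' k))
    (g := fun x => x.transpose * Λ.v k) ?_ 0 x
  intro (x : Matrix (Fin d) (Fin 1) F) (y : Matrix (Fin d) (Fin 1) F) hxy
  obtain ⟨h12, h3⟩ := Prod.mk.inj hxy
  obtain ⟨h1, h2⟩ := Prod.mk.inj h12
  have row : ∀ {n : ℕ} (z : Matrix (Fin d) (Fin 1) F) (v : Matrix (Fin d) (Fin n) F) (i : Fin 1),
      (z.transpose * v) i = Matrix.vecMul (z.col 0) v := by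
    intro n z v i
    rw [Subsingleton.elim i 0]
    rfl
  have h3' : Matrix.vecMul (x.col 0) (Λ.v' k) = Matrix.vecMul (y.col 0) (Λ.v' k) := by
    rw [← row x _ 0, ← row y _ 0, h3]
  have h4 : Matrix.vecMul (x.col 0) (Λ.v k) = Matrix.vecMul (y.col 0) (Λ.v k) := by
    refine cosetResidue_inj (mem_ambiguity.mpr ⟨x.col 0 - y.col 0, ?_, ?_, ?_⟩) (congrFun h2 k)
    · rw [map_sub, h1, sub_self]
    · rw [Matrix.sub_vecMul, h3', sub_self]
    · rw [Matrix.sub_vecMul]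
  exact funext fun i => (row x _ i).trans (h4.trans (row y _ i).symm)

lemma optCost_le_of_ambiguity [Finite F] {S : Type} [AddCommGroup S] [Finite S]
    (φ : (Fin d → F) →+ S) (Λ : Inst F K d m m') {δ : ℝ}
    (h : ∀ k, (Nat.card (ambiguity φ Λ k) : ℝ) ≤ (Nat.card F : ℝ) ^ δ) :
    optCost Λ ≤ Real.logb (Nat.card F) (Nat.card S) + K * δ := by
  refine (optCost_le (residueScheme_achieves φ Λ)).trans ?_
  have hq : (1 : ℝ) < Nat.card F := by exact_mod_cast Finite.one_lt_card
  have hS : (Nat.card S : ℝ) ≠ 0 := by exact_mod_cast Nat.card_pos.ne'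
  have hA : ∀ k, (Nat.card (ambiguity φ Λ k) : ℝ) ≠ 0 :=
    fun k => by exact_mod_cast Nat.card_pos.ne'
  have hcost : (residueScheme φ Λ).cost = Real.logb (Nat.card F) (Nat.card S) +
      ∑ k, Real.logb (Nat.card F) (Nat.card (ambiguity φ Λ k)) := by
    change Real.logb (Nat.card F) (Nat.card (S × (∀ k, ambiguity φ Λ k))) / ((1 : ℕ) : ℝ) = _
    rw [Nat.card_prod, Nat.card_pi, Nat.cast_one, div_one, Nat.cast_mul, Nat.cast_prod,
      Real.logb_mul hS (Finset.prod_ne_zero_iff.mpr fun k _ => hA k), Real.logb_prod]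
    exact fun k _ => hA k
  rw [hcost]
  gcongr
  calc _ ≤ ∑ _k : Fin K, δ := by
        refine Finset.sum_le_sum fun k _ => ?_
        rw [Real.logb_le_iff_le_rpow hq (by have := hA k; positivity)]
        exact h k
    _ = _ := by simp

lemma le_optCost [Finite F] {Λ : Inst F K d m m'} {c : ℝ}
    (h : ∀ σ : Scheme F K d m m', σ.Achieves Λ → c ≤ σ.cost) : c ≤ optCost Λ := by
  refine le_csInf ?_ ?_
  -- Some achievable scheme must be exhibited, since `sInf ∅ = 0`; here all the data is sent.
  · exact ⟨_, residueScheme (AddMonoidHom.id (Fin d → F)) Λ, residueScheme_achieves _ Λ, rfl⟩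
  · rintro _ ⟨σ, hσ, rfl⟩
    exact h σ hσ

end Achievability

/-! ### Disjoint translates of a subspace of a finite field -/

section Tiling

variable {k F : Type*} [Field k] [Field F] [Algebra k F] [FiniteDimensional k F]

/-- A bad `z` is a quotient of an element of `E` by a nonzero element of `W`; there are fewer than
`|W| |E| ≤ |F|` such quotients. -/
lemma exists_disjoint_map_mulLeft [Finite k] (W E : Submodule k F)
    (hW : 0 < Module.finrank k W)
    (h : Module.finrank k W + Module.finrank k E ≤ Module.finrank k F) :
    ∃ z : F, z ≠ 0 ∧ Disjoint E (W.map (LinearMap.mulLeft k z)) := by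
  have hfin : Finite F := Module.finite_of_finite k
  have : ∃ z : F, ∀ w ∈ W, w ≠ 0 → z * w ∉ E := by
    by_contra hcon
    push Not at hcon
    let g : {w : W // w ≠ 0} × E → F := fun a => a.2.1 / a.1.1.1
    have hg : Function.Surjective g := by
      intro z
      obtain ⟨w, hw, hw0, hz⟩ := hcon z
      exact ⟨(⟨⟨w, hw⟩, fun h => hw0 (congrArg Subtype.val h)⟩, ⟨z * w, hz⟩),
        mul_div_cancel_right₀ z hw0⟩
    have h1 := Nat.card_le_card_of_surjective g hg
    have h2 : Nat.card {w : W // w ≠ 0} < Nat.card W :=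
      Finite.card_subtype_lt (x := (0 : W)) (by simp)
    have h3 : Nat.card W * Nat.card E ≤ Nat.card F := by
      rw [Module.natCard_eq_pow_finrank (K := k) (V := W),
        Module.natCard_eq_pow_finrank (K := k) (V := E),
        Module.natCard_eq_pow_finrank (K := k) (V := F), ← pow_add]
      exact Nat.pow_le_pow_right Nat.card_pos h
    rw [Nat.card_prod] at h1
    have h4 : 0 < Nat.card E := Nat.card_pos
    nlinarith
  obtain ⟨z, hz⟩ := this
  refine ⟨z, ?_, ?_⟩
  · rintro rfl
    obtain ⟨⟨w, hw⟩, hw0⟩ := Module.finrank_pos_iff_exists_ne_zero.mp hW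
    exact hz w hw (fun h => hw0 (Subtype.ext h)) (by simp)
  · rw [Submodule.disjoint_def]
    rintro x hx ⟨w, hw, rfl⟩
    by_contra hne
    refine hz w hw ?_ hx
    rintro rfl
    simp at hne

/-- Disjoint translates of a nearly invariant space. -/
lemma exists_tiling {κ : Type*} [Finite k] (e : κ → F) {W W' : Submodule k F}
    (hW : 0 < Module.finrank k W) (he : ∀ i, ∀ w ∈ W, e i * w ∈ W') (r : ℕ)
    (hr : r * Module.finrank k W ≤ Module.finrank k F) :
    ∃ E E' : Submodule k F, Module.finrank k E = r * Module.finrank k W ∧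
      Module.finrank k E' ≤ r * Module.finrank k W' ∧ ∀ i, ∀ w ∈ E, e i * w ∈ E' := by
  induction r with
  | zero =>
    refine ⟨⊥, ⊥, by simp, by simp, ?_⟩
    rintro i w hw
    rw [Submodule.mem_bot] at hw ⊢
    rw [hw, mul_zero]
  | succ r ih =>
    rw [add_mul, one_mul] at hr
    obtain ⟨E, E', h1, h2, h3⟩ := ih (by omega)
    obtain ⟨z, hz0, hz⟩ := exists_disjoint_map_mulLeft W E hW (by omega)
    have hinj : Function.Injective (LinearMap.mulLeft k z) := mul_right_injective₀ hz0
    refine ⟨E ⊔ W.map (LinearMap.mulLeft k z), E' ⊔ W'.map (LinearMap.mulLeft k z), ?_, ?_, ?_⟩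
    · have h4 := Submodule.finrank_sup_add_finrank_inf_eq E (W.map (LinearMap.mulLeft k z))
      rw [hz.eq_bot, finrank_bot, ← (Submodule.equivMapOfInjective _ hinj W).finrank_eq] at h4
      linarith
    · have h4 := Submodule.finrank_add_le_finrank_add_finrank E' (W'.map (LinearMap.mulLeft k z))
      have h5 := Submodule.finrank_map_le (LinearMap.mulLeft k z) W'
      linarith
    · intro i x hx
      obtain ⟨a, ha, _, ⟨w, hw, rfl⟩, rfl⟩ := Submodule.mem_sup.mp hx
      refine Submodule.mem_sup.mpr ⟨e i * a, h3 i a ha, z * (e i * w),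
        ⟨e i * w, he i w hw, rfl⟩, ?_⟩
      rw [LinearMap.mulLeft_apply]
      ring

end Tiling

/-! ### Nearly invariant monomial spans and their trace duals -/

section Alignment

/-- The span of the monomials in the `e i` with all exponents less than `η`. -/
def monomialSpan (k : Type*) {F ι : Type*} [Field k] [Field F] [Algebra k F] [Fintype ι]
    (e : ι → F) (η : ℕ) : Submodule k F :=
  Submodule.span k (Set.range fun a : ι → Fin η => ∏ i, e i ^ (a i : ℕ))

variable {k F ι : Type*} [Field k] [Field F] [Algebra k F] [Fintype ι]

lemma one_mem_monomialSpan (e : ι → F) (η : ℕ) : (1 : F) ∈ monomialSpan k e (η + 1) :=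
  Submodule.subset_span ⟨fun _ => 0, by simp⟩

lemma finrank_monomialSpan_le (e : ι → F) (η : ℕ) :
    Module.finrank k (monomialSpan k e η) ≤ η ^ Fintype.card ι := by
  classical
  refine (finrank_range_le_card _).trans ?_
  simp

lemma mul_mem_monomialSpan (e : ι → F) {η : ℕ} (i : ι) {w : F} (hw : w ∈ monomialSpan k e η) :
    e i * w ∈ monomialSpan k e (η + 1) := by
  classical
  refine Submodule.span_induction (p := fun w _ => e i * w ∈ monomialSpan k e (η + 1))
    ?_ ?_ ?_ ?_ hw
  · rintro _ ⟨a, rfl⟩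
    refine Submodule.subset_span ⟨fun j => if j = i then (a j).succ else (a j).castSucc, ?_⟩
    simp only
    rw [← Finset.mul_prod_erase _ _ (Finset.mem_univ i),
      ← Finset.mul_prod_erase Finset.univ (fun j => e j ^ (a j : ℕ)) (Finset.mem_univ i),
      ← mul_assoc]
    congr 1
    · simp [pow_succ']
    · refine Finset.prod_congr rfl fun j hj => ?_
      rw [if_neg (Finset.ne_of_mem_erase hj)]
      simp
  · simp
  · intro x y _ _ hx hy
    rw [mul_add]
    exact add_mem hx hy
  · intro c x _ hx
    rw [mul_smul_comm]
    exact Submodule.smul_mem _ c hx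

/-- A bound on the exponents up to which the spaces of monomials in `T` elements are searched for
one that is nearly invariant. -/
lemma exists_pow_lt (T : ℕ) {ε : ℝ} (hε : 0 < ε) :
    ∃ N : ℕ, ((N + 1 : ℕ) : ℝ) ^ T < (1 + ε) ^ N := by
  have h := tendsto_pow_const_div_const_pow_of_one_lt T (show 1 < 1 + ε by linarith)
  have h' := (h.comp (tendsto_add_atTop_nat 1)).eventually
    (gt_mem_nhds (show (0 : ℝ) < 1 / (1 + ε) by positivity))
  obtain ⟨N, hN⟩ := h'.exists
  refine ⟨N, ?_⟩
  simp only [Function.comp_apply] at hN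
  rw [div_lt_div_iff₀ (by positivity) (by positivity), pow_succ, one_mul] at hN
  exact lt_of_mul_lt_mul_right hN (by positivity)

variable [FiniteDimensional k F]

/-- Among the spaces of monomials with bounded exponents there is one that grows by a factor of at
most `1 + ε` under multiplication by the `e i`. -/
lemma exists_nearly_invariant (e : ι → F) {ε : ℝ} {N : ℕ} (hε : 0 < ε)
    (hN : ((N + 1 : ℕ) : ℝ) ^ Fintype.card ι < (1 + ε) ^ N) :
    ∃ W W' : Submodule k F, 0 < Module.finrank k W ∧
      Module.finrank k W ≤ N ^ Fintype.card ι ∧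
      (Module.finrank k W' : ℝ) ≤ (1 + ε) * Module.finrank k W ∧
      ∀ i, ∀ w ∈ W, e i * w ∈ W' := by
  have hpos : ∀ η, 0 < Module.finrank k (monomialSpan k e (η + 1)) := by
    intro η
    rw [Module.finrank_pos_iff_exists_ne_zero]
    exact ⟨⟨1, one_mem_monomialSpan e η⟩, fun h => one_ne_zero (congrArg Subtype.val h)⟩
  -- Otherwise the dimension grows by a factor above `1 + ε` at each of `N` steps, starting from at
  -- least `1`. This contradicts the polynomial bound `(N + 1) ^ card ι`.
  by_contra hcon
  push Not at hcon
  have hgrow : ∀ η ≤ N, (1 + ε) ^ η ≤ (Module.finrank k (monomialSpan k e (η + 1)) : ℝ) := by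
    intro η
    induction η with
    | zero =>
      intro _
      rw [pow_zero]
      exact_mod_cast hpos 0
    | succ η ih =>
      intro hη
      by_contra hlt
      push Not at hlt
      obtain ⟨i, w, hw, hw'⟩ := hcon (monomialSpan k e (η + 1)) (monomialSpan k e (η + 2)) (hpos η)
        ((finrank_monomialSpan_le e _).trans (Nat.pow_le_pow_left hη _)) (by
          have := ih (by omega)
          rw [pow_succ] at hlt
          nlinarith)
      exact hw' (mul_mem_monomialSpan e i hw)
  have h1 := hgrow N le_rfl
  have h2 : (Module.finrank k (monomialSpan k e (N + 1)) : ℝ) ≤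
      ((N + 1 : ℕ) : ℝ) ^ Fintype.card ι := by
    exact_mod_cast finrank_monomialSpan_le e (N + 1)
  linarith

/-- Spaces `Z`, `Z₀` of prescribed codimension, nearly equal to one another, such that every `e i`
maps `Z` to `Z₀`. -/
lemma exists_aligned [Finite k] (e : ι → F) {ε : ℝ} {N : ℕ} (hε : 0 < ε)
    (hN : ((N + 1 : ℕ) : ℝ) ^ Fintype.card ι < (1 + ε) ^ N) {D : ℕ}
    (hD : D ≤ Module.finrank k F) :
    ∃ (Z Z₀ : Submodule k F) (D₀ : ℕ), D₀ ≤ D ∧ D ≤ D₀ + N ^ Fintype.card ι ∧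
      Module.finrank k Z₀ + D₀ = Module.finrank k F ∧
      (Module.finrank k F : ℝ) ≤ Module.finrank k Z + (1 + ε) * D₀ ∧
      ∀ i, ∀ z ∈ Z, e i * z ∈ Z₀ := by
  have hfin : Finite F := Module.finite_of_finite k
  obtain ⟨W, W', hW, hWN, hW', he⟩ := exists_nearly_invariant (k := k) e hε hN
  have hdiv := Nat.div_mul_le_self D (Module.finrank k W)
  have hmod := Nat.lt_div_mul_add (a := D) hW
  -- The number of tiles is `D / dim W` rounded down; the loss is less than `dim W`, which is at
  -- most `N ^ card ι` whatever the degree of `F`.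
  obtain ⟨E, E', hE, hE', heE⟩ := exists_tiling e hW he (D / Module.finrank k W) (by omega)
  have hnd := traceForm_nondegenerate k F
  -- Multiplication by `e i` is self-adjoint for the trace form: as it maps `E` into `E'`, it maps
  -- the complement of `E'` into that of `E`.
  refine ⟨(Algebra.traceForm k F).orthogonal E', (Algebra.traceForm k F).orthogonal E,
    D / Module.finrank k W * Module.finrank k W, hdiv, by omega, ?_, ?_, ?_⟩
  · rw [LinearMap.BilinForm.finrank_orthogonal hnd, hE]
    omega
  · rw [LinearMap.BilinForm.finrank_orthogonal hnd, Nat.cast_sub (Submodule.finrank_le _)]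
    have h1 : (Module.finrank k E' : ℝ) ≤
        (D / Module.finrank k W : ℕ) * Module.finrank k W' := by exact_mod_cast hE'
    have h2 := mul_le_mul_of_nonneg_left hW' (Nat.cast_nonneg (α := ℝ) (D / Module.finrank k W))
    push_cast at *
    linarith
  · intro i z hz
    rw [LinearMap.BilinForm.mem_orthogonal_iff] at hz ⊢
    intro w hw
    have := hz (e i * w) (heE i w hw)
    rw [Algebra.traceForm_apply] at this ⊢
    rw [← this]
    congr 1
    ring

end Alignment

/-! ### Counting probabilities, first moments and resampling -/

section Probability

/-- The probability of an event for a uniformly distributed element of `α`. -/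
noncomputable def pr {α : Type*} (E : α → Prop) : ℝ :=
  (Nat.card {a // E a} : ℝ) / Nat.card α

lemma prob_eq_pr (p : ℕ) [Fact p.Prime] (n K d m m' : ℕ)
    (E : Inst (GaloisField p n) K d m m' → Prop) : prob p n K d m m' E = pr E := rfl

variable {α β : Type*}

open Classical in
lemma natCard_subtype_eq_sum [Fintype α] (E : α → Prop) :
    (Nat.card {a // E a} : ℝ) = ∑ a, if E a then 1 else 0 := by
  rw [Nat.card_eq_fintype_card, Fintype.card_subtype]
  simp

lemma pr_nonneg (E : α → Prop) : 0 ≤ pr E := by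
  unfold pr
  positivity

lemma pr_mono [Finite α] {E E' : α → Prop} (h : ∀ a, E a → E' a) : pr E ≤ pr E' := by
  unfold pr
  gcongr
  exact Nat.card_mono (Set.toFinite {a | E' a}) h

lemma pr_le_one [Finite α] (E : α → Prop) : pr E ≤ 1 := by
  refine div_le_one_of_le₀ ?_ (Nat.cast_nonneg _)
  exact_mod_cast Finite.card_subtype_le E

lemma pr_or_le [Finite α] (E E' : α → Prop) : pr (fun a => E a ∨ E' a) ≤ pr E + pr E' := by
  classical
  have := Fintype.ofFinite α
  unfold pr
  rw [← add_div]
  gcongr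
  simp only [natCard_subtype_eq_sum, ← Finset.sum_add_distrib]
  refine Finset.sum_le_sum fun a _ => ?_
  by_cases h1 : E a <;> by_cases h2 : E' a <;> simp [h1, h2]

lemma pr_exists_le [Finite α] {κ : Type*} [Fintype κ] (E : κ → α → Prop) :
    pr (fun a => ∃ i, E i a) ≤ ∑ i, pr (E i) := by
  classical
  have := Fintype.ofFinite α
  unfold pr
  rw [← Finset.sum_div]
  gcongr
  simp only [natCard_subtype_eq_sum]
  rw [Finset.sum_comm]
  refine Finset.sum_le_sum fun a _ => ?_
  split_ifs with h
  · obtain ⟨i, hi⟩ := h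
    refine le_trans ?_ (Finset.single_le_sum (f := fun i => if E i a then (1 : ℝ) else 0)
      (fun j _ => by split_ifs <;> norm_num) (Finset.mem_univ i))
    simp [hi]
  · exact Finset.sum_nonneg fun j _ => by split_ifs <;> norm_num

lemma pr_not [Finite α] [Nonempty α] (E : α → Prop) : pr (fun a => ¬ E a) = 1 - pr E := by
  classical
  have := Fintype.ofFinite α
  have hc : (Nat.card α : ℝ) ≠ 0 := by exact_mod_cast Nat.card_pos.ne'
  rw [eq_sub_iff_add_eq]
  unfold pr
  rw [← add_div, div_eq_one_iff_eq hc]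
  simp only [natCard_subtype_eq_sum, ← Finset.sum_add_distrib]
  rw [Finset.sum_congr rfl (g := fun _ => (1 : ℝ)) fun a _ => by by_cases h : E a <;> simp [h]]
  simp

lemma pr_comp_equiv (e : α ≃ β) (E : β → Prop) : pr (fun a => E (e a)) = pr E := by
  unfold pr
  rw [Nat.card_congr e, Nat.card_congr (e.subtypeEquiv (p := fun a => E (e a)) fun _ => Iff.rfl)]

/-- The first-moment bound for the number of elements in a random set. -/
lemma pr_le_card_le [Finite α] [Fintype β] (R : α → β → Prop) {T : ℝ} (hT : 0 < T) :
    pr (fun a => T ≤ Nat.card {y // R a y}) ≤ (∑ y, pr fun a => R a y) / T := by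
  classical
  have := Fintype.ofFinite α
  rw [le_div_iff₀ hT]
  unfold pr
  rw [← Finset.sum_div, div_mul_eq_mul_div]
  gcongr
  simp only [natCard_subtype_eq_sum]
  rw [Finset.sum_comm, Finset.sum_mul]
  refine Finset.sum_le_sum fun a _ => ?_
  by_cases h : T ≤ ∑ y, if R a y then (1 : ℝ) else 0
  · rwa [if_pos h, one_mul]
  · simp only [h, if_false, zero_mul]
    exact Finset.sum_nonneg fun j _ => by split_ifs <;> norm_num

/-- The variant of `pr_le_card_le` in which all but one element lie in a given set and are hit with
probability at most `c`. -/
lemma pr_le_card_le_of_le [Finite α] [Finite β] (R : α → β → Prop) (y₀ : β) (B : Set β) {c T : ℝ}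
    (hc : 0 ≤ c) (hT : 0 < T) (hB : ∀ a y, R a y → y ∈ B)
    (hR : ∀ y ∈ B, y ≠ y₀ → pr (fun a => R a y) ≤ c) :
    pr (fun a => T ≤ Nat.card {y // R a y}) ≤ (1 + Nat.card B * c) / T := by
  classical
  have := Fintype.ofFinite β
  refine (pr_le_card_le R hT).trans ?_
  gcongr
  have h0 : ∀ y, pr (fun a => R a y) ≤ (if y = y₀ then 1 else 0) + if y ∈ B then c else 0 := by
    intro y
    by_cases hy : y = y₀
    · rw [if_pos hy]
      have : (0 : ℝ) ≤ if y ∈ B then c else 0 := by split_ifs <;> simp [hc]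
      linarith [pr_le_one fun a => R a y]
    · rw [if_neg hy, zero_add]
      split_ifs with hyB
      · exact hR y hyB hy
      · have : ∀ a, ¬ R a y := fun a h => hyB (hB a y h)
        simp [pr, this]
  refine (Finset.sum_le_sum fun y _ => h0 y).trans ?_
  rw [Finset.sum_add_distrib]
  have h1 : (Nat.card B : ℝ) = ∑ y, if y ∈ B then 1 else 0 := natCard_subtype_eq_sum (· ∈ B)
  rw [h1, Finset.sum_mul]
  simp

/-- The fibres of a surjective homomorphism are equivalent to its kernel. -/
noncomputable def preimageEquiv {G H : Type*} [AddCommGroup G] [AddCommGroup H] (φ : G →+ H)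
    (hφ : Function.Surjective φ) (P : H → Prop) : {g // P (φ g)} ≃ {h // P h} × φ.ker where
  toFun g := (⟨φ g, g.2⟩, ⟨g - Function.surjInv hφ (φ g), by
    rw [AddMonoidHom.mem_ker, map_sub, Function.surjInv_eq hφ, sub_self]⟩)
  invFun a := ⟨Function.surjInv hφ a.1 + a.2, by
    rw [map_add, a.2.2, add_zero, Function.surjInv_eq hφ]
    exact a.1.2⟩
  left_inv g := by simp
  right_inv a := by
    obtain ⟨⟨h, hh⟩, ⟨x, hx⟩⟩ := a
    rw [AddMonoidHom.mem_ker] at hx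
    simp [hx, Function.surjInv_eq hφ]

/-- A surjective homomorphism maps the uniform distribution to the uniform distribution. -/
lemma pr_hom {G H : Type*} [AddCommGroup G] [AddCommGroup H] [Finite G] (φ : G →+ H)
    (hφ : Function.Surjective φ) (P : H → Prop) : pr (fun g => P (φ g)) = pr P := by
  have : Finite H := Finite.of_surjective φ hφ
  have hker : (Nat.card φ.ker : ℝ) ≠ 0 := by exact_mod_cast Nat.card_pos.ne'
  have h1 : Nat.card G = Nat.card H * Nat.card φ.ker := by
    have := Nat.card_congr (preimageEquiv φ hφ fun _ => True)
    rwa [Nat.card_prod, Nat.card_congr (Equiv.subtypeUnivEquiv fun _ => trivial),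
      Nat.card_congr (Equiv.subtypeUnivEquiv fun _ => trivial)] at this
  unfold pr
  rw [Nat.card_congr (preimageEquiv φ hφ P), Nat.card_prod, h1, Nat.cast_mul, Nat.cast_mul,
    mul_div_mul_right _ _ hker]

/-- An event has probability at most `c` if it has after resampling by independent translations. -/
lemma pr_le_of_translate {G γ : Type*} [AddCommGroup G] [Finite G] [Finite γ] [Nonempty γ]
    (ins : γ → G) (E : G → Prop) {c : ℝ} (h : ∀ g, pr (fun x => E (g + ins x)) ≤ c) :
    pr E ≤ c := by
  classical
  have := Fintype.ofFinite G
  have := Fintype.ofFinite γ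
  have hG : (0 : ℝ) < Nat.card G := by exact_mod_cast Nat.card_pos
  have hγ : (0 : ℝ) < Nat.card γ := by exact_mod_cast Nat.card_pos
  have h1 : ∀ x, ∑ g, (if E (g + ins x) then (1 : ℝ) else 0) = ∑ g, if E g then 1 else 0 :=
    fun x => Equiv.sum_comp (Equiv.addRight (ins x)) fun g => if E g then (1 : ℝ) else 0
  have h2 : (Nat.card γ : ℝ) * ∑ g, (if E g then (1 : ℝ) else 0) ≤
      Nat.card G * (c * Nat.card γ) := by
    calc _ = ∑ x : γ, ∑ g, (if E (g + ins x) then (1 : ℝ) else 0) := by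
          simp only [h1, Finset.sum_const, Finset.card_univ, nsmul_eq_mul,
            Nat.card_eq_fintype_card]
      _ = ∑ g, ∑ x : γ, (if E (g + ins x) then (1 : ℝ) else 0) := Finset.sum_comm
      _ ≤ ∑ _g : G, c * Nat.card γ := by
          refine Finset.sum_le_sum fun g _ => ?_
          have := h g
          rwa [pr, div_le_iff₀ hγ, natCard_subtype_eq_sum] at this
      _ = _ := by simp
  unfold pr
  rw [natCard_subtype_eq_sum, div_le_iff₀ hG]
  nlinarith

/-- Existence of a good auxiliary choice, from a bound for each value of a transformed sample. -/
lemma pr_le_of_forall [Finite α] [Finite β] [Nonempty β] [Nonempty α] (τ : β → α ≃ α)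
    (E : α → β → Prop) (P : α → Prop)
    (hP : ∀ a, P a → ∀ b, E (τ b a) b) {c : ℝ} (h : ∀ a, pr (fun b => E a b) ≤ c) :
    pr P ≤ c := by
  classical
  have := Fintype.ofFinite α
  have := Fintype.ofFinite β
  have hα : (0 : ℝ) < Nat.card α := by exact_mod_cast Nat.card_pos
  have hβ : (0 : ℝ) < Nat.card β := by exact_mod_cast Nat.card_pos
  have h2 : (Nat.card β : ℝ) * ∑ a, (if P a then (1 : ℝ) else 0) ≤
      Nat.card α * (c * Nat.card β) := by
    calc _ = ∑ _b : β, ∑ a, (if P a then (1 : ℝ) else 0) := by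
          simp only [Finset.sum_const, Finset.card_univ, nsmul_eq_mul, Nat.card_eq_fintype_card]
      _ ≤ ∑ b : β, ∑ a, (if E (τ b a) b then (1 : ℝ) else 0) := by
          refine Finset.sum_le_sum fun b _ => Finset.sum_le_sum fun a _ => ?_
          by_cases h : P a
          · rw [if_pos h, if_pos (hP a h b)]
          · rw [if_neg h]
            split_ifs <;> norm_num
      _ = ∑ b : β, ∑ a, (if E a b then (1 : ℝ) else 0) :=
          Finset.sum_congr rfl fun b _ =>
            Equiv.sum_comp (τ b) fun a => if E a b then (1 : ℝ) else 0
      _ = ∑ a, ∑ b : β, (if E a b then (1 : ℝ) else 0) := Finset.sum_comm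
      _ ≤ ∑ _a : α, c * Nat.card β := by
          refine Finset.sum_le_sum fun a _ => ?_
          have := h a
          rwa [pr, div_le_iff₀ hβ, natCard_subtype_eq_sum] at this
      _ = _ := by simp
  unfold pr
  rw [natCard_subtype_eq_sum, div_le_iff₀ hα]
  nlinarith

lemma pr_eq_point [Finite β] (b : β) : pr (fun x => x = b) = 1 / Nat.card β := by
  unfold pr
  rw [Nat.card_unique, Nat.cast_one]

end Probability

/-! ### General position of the column space of a random matrix -/

section RandomMatrix

lemma card_le_card_of_ne_zero {F V : Type*} [Field F] [AddCommGroup V] [Module F V] [Finite V]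
    (X : Submodule F V) {x : V} (hx : x ∈ X) (h0 : x ≠ 0) : Nat.card F ≤ Nat.card X := by
  refine Nat.card_le_card_of_injective (fun a : F => (⟨a • x, X.smul_mem a hx⟩ : X)) ?_
  intro a b hab
  exact smul_left_injective F h0 (congrArg Subtype.val hab)

variable {F : Type*} [Field F] [Finite F] {ι κ : Type*} [Fintype ι] [Fintype κ]

lemma pr_vecMul {y : κ → F} (hy : y ≠ 0) (P : (ι → F) → Prop) :
    pr (fun M : Matrix κ ι F => P (Matrix.vecMul y M)) = pr P := by
  classical
  let φ : Matrix κ ι F →+ (ι → F) :=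
    { toFun := fun M => Matrix.vecMul y M
      map_zero' := Matrix.vecMul_zero y
      map_add' := fun M N => Matrix.vecMul_add M N y }
  refine pr_hom φ (fun b => ?_) P
  obtain ⟨i, hi⟩ := Function.ne_iff.mp hy
  refine ⟨Matrix.vecMulVec (Pi.single i (y i)⁻¹) b, ?_⟩
  change Matrix.vecMul y (Matrix.vecMulVec (Pi.single i (y i)⁻¹) b) = b
  rw [Matrix.vecMul_vecMulVec, dotProduct_single, mul_inv_cancel₀ hi, one_smul]

lemma pr_mulVec {c : ι → F} (hc : c ≠ 0) (P : (κ → F) → Prop) :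
    pr (fun M : Matrix κ ι F => P (M.mulVec c)) = pr P := by
  classical
  let e : Matrix κ ι F ≃ Matrix ι κ F := ⟨Matrix.transpose, Matrix.transpose,
    Matrix.transpose_transpose, Matrix.transpose_transpose⟩
  rw [← pr_vecMul hc P, ← pr_comp_equiv e]
  simp [e, Matrix.vecMul_transpose]

/-- A random matrix is injective modulo a subspace `A` of small dimension. -/
lemma pr_exists_mulVec_mem_le (A : Submodule F (κ → F))
    (hA : Module.finrank F A + Fintype.card ι ≤ Fintype.card κ) :
    pr (fun M : Matrix κ ι F => ∃ c, c ≠ 0 ∧ M.mulVec c ∈ A) ≤ 2 / Nat.card F := by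
  have hq : (0 : ℝ) < Nat.card F := by exact_mod_cast Nat.card_pos
  -- One nonzero solution brings all its scalar multiples, hence at least `q` solutions, while the
  -- expected number is at most `2`.
  refine (pr_mono (E' := fun M : Matrix κ ι F =>
    (Nat.card F : ℝ) ≤ Nat.card {c // M.mulVec c ∈ A}) ?_).trans
    ((pr_le_card_le_of_le (fun (M : Matrix κ ι F) c => M.mulVec c ∈ A) 0 Set.univ
      (pr_nonneg (· ∈ A)) hq (fun _ _ _ => trivial)
      fun c _ hc => (pr_mulVec hc (· ∈ A)).le).trans ?_)
  · rintro M ⟨c, hc, hMc⟩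
    exact_mod_cast card_le_card_of_ne_zero (A.comap M.mulVecLin) (x := c) hMc hc
  · gcongr
    have h1 : (Nat.card (Set.univ : Set (ι → F)) : ℝ) = (Nat.card F : ℝ) ^ Fintype.card ι := by
      rw [Nat.card_univ, Nat.card_fun]
      simp
    have h2 : pr (· ∈ A) = (Nat.card F : ℝ) ^ Module.finrank F A /
        (Nat.card F : ℝ) ^ Fintype.card κ := by
      unfold pr
      rw [← Nat.cast_pow, ← Module.natCard_eq_pow_finrank, Nat.card_fun]
      simp
    rw [h1, h2, mul_div_assoc', ← pow_add, ← one_add_one_eq_two]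
    gcongr
    refine div_le_one_of_le₀ (pow_le_pow_right₀ ?_ (by omega)) (by positivity)
    exact_mod_cast Finite.one_lt_card.le

/-- The columns of a random matrix span the space modulo a subspace `A` of large dimension. -/
lemma pr_sup_range_ne_top_le (A : Submodule F (κ → F))
    (hA : Fintype.card κ ≤ Module.finrank F A + Fintype.card ι) :
    pr (fun M : Matrix κ ι F => A ⊔ LinearMap.range M.mulVecLin ≠ ⊤) ≤ 2 / Nat.card F := by
  classical
  have hq : (0 : ℝ) < Nat.card F := by exact_mod_cast Nat.card_pos
  -- `X` is the annihilator of `A` under the dot product. If the span is proper, some nonzero `y` in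
  -- `X` is orthogonal to all columns, and so are its `q` multiples; the expected number of such
  -- `y`, zero included, is at most `2`.
  let X : Submodule F (κ → F) := (A.dualAnnihilator).comap (dotProductEquiv F κ).toLinearMap
  have hX : ∀ {y}, y ∈ X ↔ ∀ a ∈ A, y ⬝ᵥ a = 0 := by
    intro y
    simp [X, Submodule.mem_dualAnnihilator]
  have hXdim : Module.finrank F A + Module.finrank F X = Fintype.card κ := by
    have h1 := Subspace.finrank_add_finrank_dualAnnihilator_eq A
    rw [Module.finrank_fintype_fun_eq_card] at h1
    rw [← h1]
    congr 1
    exact LinearEquiv.finrank_eq ((dotProductEquiv F κ).ofSubmodule' A.dualAnnihilator)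
  refine (pr_mono (E' := fun M : Matrix κ ι F =>
    (Nat.card F : ℝ) ≤ Nat.card {y // y ∈ X ∧ Matrix.vecMul y M = 0}) ?_).trans
    ((pr_le_card_le_of_le (fun (M : Matrix κ ι F) y => y ∈ X ∧ Matrix.vecMul y M = 0) 0 X
      (pr_nonneg (fun b : ι → F => b = 0)) hq (fun _ _ h => h.1)
      fun y _ hy => (pr_mono fun M h => h.2).trans (pr_vecMul hy fun b => b = 0).le).trans ?_)
  · intro M hM
    obtain ⟨f, hf0, hf⟩ := Submodule.exists_le_ker_of_lt_top _ (lt_top_iff_ne_top.mpr hM)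
    obtain ⟨y, rfl⟩ := (dotProductEquiv F κ).surjective f
    have hy0 : y ≠ 0 := by
      rintro rfl
      simp at hf0
    have hyX : y ∈ X := hX.mpr fun a ha => hf (Submodule.mem_sup_left ha)
    have hyM : Matrix.vecMul y M = 0 := by
      funext j
      have : y ⬝ᵥ M.mulVec (Pi.single j 1) = 0 :=
        hf (Submodule.mem_sup_right ⟨Pi.single j 1, rfl⟩)
      rw [Matrix.dotProduct_mulVec, dotProduct_single, mul_one] at this
      exact this
    exact_mod_cast card_le_card_of_ne_zero (X ⊓ LinearMap.ker M.vecMulLinear) (x := y)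
      ⟨hyX, hyM⟩ hy0
  · gcongr
    have h1 : (Nat.card X : ℝ) = (Nat.card F : ℝ) ^ Module.finrank F X := by
      rw [← Nat.cast_pow, ← Module.natCard_eq_pow_finrank]
    have h2 : pr (fun b : ι → F => b = 0) = 1 / (Nat.card F : ℝ) ^ Fintype.card ι := by
      rw [pr_eq_point, Nat.card_fun]
      simp
    change 1 + (Nat.card X : ℝ) * _ ≤ 2
    rw [h1, h2, mul_one_div, ← one_add_one_eq_two]
    gcongr
    refine div_le_one_of_le₀ (pow_le_pow_right₀ ?_ (by omega)) (by positivity)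
    exact_mod_cast Finite.one_lt_card.le

/-- The column space of a random matrix is in general position with respect to a subspace. -/
lemma pr_not_generalPosition_le (A : Submodule F (κ → F))
    (hικ : Fintype.card ι ≤ Fintype.card κ) :
    pr (fun M : Matrix κ ι F =>
      ¬ (Module.finrank F (LinearMap.range M.mulVecLin) = Fintype.card ι ∧
        (A ⊓ LinearMap.range M.mulVecLin = ⊥ ∨ A ⊔ LinearMap.range M.mulVecLin = ⊤))) ≤
      4 / Nat.card F := by
  have h1 := pr_exists_mulVec_mem_le (ι := ι) (⊥ : Submodule F (κ → F)) (by simpa using hικ)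
  have h2 : pr (fun M : Matrix κ ι F =>
      ¬ (A ⊓ LinearMap.range M.mulVecLin = ⊥ ∨ A ⊔ LinearMap.range M.mulVecLin = ⊤)) ≤
      2 / Nat.card F := by
    rcases le_total (Module.finrank F A + Fintype.card ι) (Fintype.card κ) with h | h
    · refine (pr_mono ?_).trans (pr_exists_mulVec_mem_le A h)
      intro M hM
      by_contra hcon
      push Not at hcon
      refine hM (Or.inl ?_)
      rw [eq_bot_iff]
      rintro _ ⟨hx, ⟨c, rfl⟩⟩
      by_cases hc : c = 0
      · simp [hc]
      · exact absurd hx (hcon c hc)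
    · exact (pr_mono fun M hM => fun h => hM (Or.inr h)).trans (pr_sup_range_ne_top_le A h)
  refine (pr_mono ?_).trans ((pr_or_le _ _).trans ((add_le_add h1 h2).trans (le_of_eq ?_)))
  · intro M hM
    by_contra hcon
    push Not at hcon
    refine hM ⟨?_, ?_⟩
    · rw [LinearMap.finrank_range_of_inj, Module.finrank_fintype_fun_eq_card]
      rw [← LinearMap.ker_eq_bot, LinearMap.ker_eq_bot']
      intro c hc
      by_contra hc0
      exact hcon.1 c hc0 (by simpa using hc)
    · exact hcon.2
  · ring

end RandomMatrix

/-! ### General position of the user spaces of a random instance -/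

section RandomInstance

variable {F : Type} [Field F] {K d m m' : ℕ}

/-- The instance with the given matrices for user `k` and zero matrices for the others. -/
def singleUser (k : Fin K) (M : Matrix (Fin d) (Fin m ⊕ Fin m') F) : Inst F K d m m' :=
  (Pi.single k M.toCols₁, Pi.single k M.toCols₂)

/-- The demands and the side-information of user `k` in one matrix. -/
def userMatrix (Λ : Inst F K d m m') (k : Fin K) : Matrix (Fin d) (Fin m ⊕ Fin m') F :=
  Matrix.fromCols (Λ.v k) (Λ.v' k)

lemma userMatrix_add_singleUser_self (Λ : Inst F K d m m') (k : Fin K)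
    (M : Matrix (Fin d) (Fin m ⊕ Fin m') F) :
    userMatrix (Λ + singleUser k M) k = userMatrix Λ k + M := by
  ext i (j | j) <;> simp [userMatrix, singleUser, Inst.v, Inst.v']

lemma userMatrix_add_singleUser_of_ne (Λ : Inst F K d m m') {k l : Fin K} (h : l ≠ k)
    (M : Matrix (Fin d) (Fin m ⊕ Fin m') F) :
    userMatrix (Λ + singleUser k M) l = userMatrix Λ l := by
  ext i (j | j) <;> simp [userMatrix, singleUser, Inst.v, Inst.v', h]

variable [Finite F]

/-- An event on the matrix of user `k` that is unlikely whatever the other users are. -/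
lemma pr_userMatrix_le (k : Fin K)
    (E : Inst F K d m m' → Matrix (Fin d) (Fin m ⊕ Fin m') F → Prop) {c : ℝ}
    (hE : ∀ Λ M, E (Λ + singleUser k M) = E Λ) (h : ∀ Λ, pr (E Λ) ≤ c) :
    pr (fun Λ => E Λ (userMatrix Λ k)) ≤ c := by
  refine pr_le_of_translate (singleUser k) _ fun Λ => ?_
  simp only [hE, userMatrix_add_singleUser_self]
  exact (pr_comp_equiv (Equiv.addLeft (userMatrix Λ k)) (E Λ)).trans_le (h Λ)

lemma pr_not_inGeneralPosition_le {N : ℕ} (hNK : N ≤ K) (hd : m + m' ≤ d) :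
    pr (fun Λ : Inst F K d m m' => ¬ InGeneralPosition (userSpaceSeq Λ) (m + m') N) ≤
      N * (4 / Nat.card F) := by
  have h1 : ∀ i : Fin N, pr (fun Λ : Inst F K d m m' =>
      ¬ (Module.finrank F (userSpaceSeq Λ i) = m + m' ∧
        (uncross (userSpaceSeq Λ) i ⊓ userSpaceSeq Λ i = ⊥ ∨
          uncross (userSpaceSeq Λ) i ⊔ userSpaceSeq Λ i = ⊤))) ≤ 4 / Nat.card F := by
    intro i
    have hi : (i : ℕ) < K := i.2.trans_le hNK
    have hU : ∀ Λ : Inst F K d m m', userSpaceSeq Λ i =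
        LinearMap.range (userMatrix Λ ⟨i, hi⟩).mulVecLin := by
      intro Λ
      rw [userSpaceSeq, dif_pos hi]
      rfl
    refine (pr_mono (fun Λ h => ?_)).trans (pr_userMatrix_le ⟨i, hi⟩ (fun Λ M =>
      ¬ (Module.finrank F (LinearMap.range M.mulVecLin) = m + m' ∧
        (uncross (userSpaceSeq Λ) i ⊓ LinearMap.range M.mulVecLin = ⊥ ∨
          uncross (userSpaceSeq Λ) i ⊔ LinearMap.range M.mulVecLin = ⊤))) (c := 4 / Nat.card F)
      (fun Λ M => ?_) fun Λ => ?_)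
    · rw [hU] at h
      exact h
    -- The running space at `i` depends only on users before `i`, so user `i` may be resampled with
    -- it fixed.
    · have : uncross (userSpaceSeq (Λ + singleUser ⟨i, hi⟩ M)) i = uncross (userSpaceSeq Λ) i := by
        refine uncross_congr fun j hj => ?_
        have hj' : j < K := hj.trans hi
        rw [userSpaceSeq, userSpaceSeq, dif_pos hj', dif_pos hj']
        change LinearMap.range (userMatrix _ _).mulVecLin = LinearMap.range (userMatrix _ _).mulVecLin
        rw [userMatrix_add_singleUser_of_ne]
        intro h
        have := congrArg Fin.val h
        simp only at this
        omega
      simp only [this]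
    · have := pr_not_generalPosition_le (ι := Fin m ⊕ Fin m') (uncross (userSpaceSeq Λ) i)
        (by simpa using hd)
      rw [Fintype.card_sum, Fintype.card_fin, Fintype.card_fin] at this
      exact this
  refine (pr_mono ?_).trans ((pr_exists_le _).trans
    ((Finset.sum_le_sum fun i _ => h1 i).trans (le_of_eq ?_)))
  · intro Λ hΛ
    unfold InGeneralPosition at hΛ
    push Not at hΛ
    obtain ⟨i, hi, h⟩ := hΛ
    refine ⟨⟨i, hi⟩, ?_⟩
    push Not
    exact h
  · simp

lemma pr_userSpace_ne_top_le (k : Fin K) (hd : d ≤ m + m') :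
    pr (fun Λ : Inst F K d m m' => userSpace Λ k ≠ ⊤) ≤ 2 / Nat.card F := by
  refine pr_userMatrix_le k (fun _ M => LinearMap.range M.mulVecLin ≠ ⊤) (fun _ _ => rfl) ?_
  intro _
  have := pr_sup_range_ne_top_le (ι := Fin m ⊕ Fin m') (⊥ : Submodule F (Fin d → F))
    (by simpa using hd)
  simpa using this

end RandomInstance

/-! ### Upper bound by sending coordinates -/

section RandomCoding

variable {F : Type} [Field F] [Finite F] {K d m m' : ℕ}

/-- For a random instance, the first `d - m'` coordinates of the data nearly suffice. -/
lemma pr_sub_lt_optCost_le {δ : ℝ} :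
    pr (fun Λ : Inst F K d m m' => ((d - m' : ℕ) : ℝ) + K * δ < optCost Λ) ≤
      K * 2 / (Nat.card F : ℝ) ^ δ := by
  have hq : (1 : ℝ) < Nat.card F := by exact_mod_cast Finite.one_lt_card
  have hq0 : (0 : ℝ) < Nat.card F := by linarith
  have hT : (0 : ℝ) < (Nat.card F : ℝ) ^ δ := Real.rpow_pos_of_pos hq0 δ
  let φ : (Fin d → F) →+ (Fin (d - m') → F) :=
    { toFun := fun x i => x (Fin.castLE (Nat.sub_le d m') i)
      map_zero' := rfl
      map_add' := fun _ _ => rfl }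
  have hφ : Function.Surjective φ := (Fin.castLE_injective (Nat.sub_le d m')).surjective_comp_right
  let R : Fin K → Inst F K d m m' → (Fin d → F) → Prop :=
    fun k Λ x => φ x = 0 ∧ Matrix.vecMul x (Λ.v' k) = 0
  -- The kernel of `φ` has at most `q^m'` elements, and `v' k` kills each nonzero one with
  -- probability `q^(-m')`. With the zero vector this gives an expectation of at most `2`.
  have hbad : ∀ k, pr (fun Λ : Inst F K d m m' =>
      (Nat.card F : ℝ) ^ δ ≤ Nat.card {x // R k Λ x}) ≤ 2 / (Nat.card F : ℝ) ^ δ := by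
    intro k
    refine (pr_le_card_le_of_le (R k) 0 {x | φ x = 0} (pr_nonneg (fun b : Fin m' → F => b = 0))
      hT (fun _ _ h => h.1) ?_).trans ?_
    · intro x _ hx
      let ψ : Inst F K d m m' →+ Matrix (Fin d) (Fin m') F :=
        { toFun := fun Λ => Λ.v' k
          map_zero' := rfl
          map_add' := fun _ _ => rfl }
      have hψ : Function.Surjective ψ := fun M => ⟨(0, fun _ => M), rfl⟩
      refine (pr_mono fun Λ h => h.2).trans (le_of_eq ?_)
      exact (pr_hom ψ hψ fun M => Matrix.vecMul x M = 0).trans (pr_vecMul hx fun b => b = 0)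
    · gcongr
      have h1 := pr_hom φ hφ (fun b => b = 0)
      rw [pr_eq_point] at h1
      have h2 : (Nat.card ({x | φ x = 0} : Set (Fin d → F)) : ℝ) =
          (Nat.card F : ℝ) ^ d / (Nat.card F : ℝ) ^ (d - m') := by
        unfold pr at h1
        rw [div_eq_iff (by exact_mod_cast Nat.card_pos.ne')] at h1
        refine h1.trans ?_
        rw [Nat.card_fun, Nat.card_fun]
        simp
        ring
      rw [h2, pr_eq_point, Nat.card_fun]
      simp only [Nat.card_eq_fintype_card, Fintype.card_fin, Nat.cast_pow]
      rw [← one_add_one_eq_two, div_mul_div_comm, mul_one, ← pow_add]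
      gcongr
      refine div_le_one_of_le₀ (pow_le_pow_right₀ ?_ (by omega)) (by positivity)
      exact_mod_cast Finite.one_lt_card.le
  refine (pr_mono ?_).trans ((pr_exists_le _).trans
    ((Finset.sum_le_sum fun k _ => hbad k).trans (le_of_eq ?_)))
  · intro Λ hΛ
    by_contra hcon
    push Not at hcon
    refine absurd (optCost_le_of_ambiguity φ Λ (δ := δ) fun k => ?_) (not_le.mpr ?_)
    · refine le_trans ?_ (hcon k).le
      have : Function.Surjective fun x : {x // R k Λ x} =>
          (⟨Matrix.vecMul x.1 (Λ.v k), mem_ambiguity.mpr ⟨x.1, x.2.1, x.2.2, rfl⟩⟩ :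
            ambiguity φ Λ k) := by
        rintro ⟨y, hy⟩
        obtain ⟨x, h1, h2, h3⟩ := mem_ambiguity.mp hy
        exact ⟨⟨x, h1, h2⟩, Subtype.ext h3⟩
      exact_mod_cast Nat.card_le_card_of_surjective _ this
    · have : Real.logb (Nat.card F) (Nat.card (Fin (d - m') → F)) = ((d - m' : ℕ) : ℝ) := by
        rw [Nat.card_fun, Nat.cast_pow, Real.logb_pow, Real.logb_self_eq_one hq]
        simp
      rwa [this]
  · simp
    ring

end RandomCoding

/-! ### Upper bound by aligned broadcasts -/

section RandomAlignment

variable {F : Type} [Field F] {K d m m' : ℕ}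

/-- Adding to the side-information of each user combinations of its demands. -/
def shear (P : Fin K → Matrix (Fin m) (Fin m') F) : Inst F K d m m' ≃ Inst F K d m m' where
  toFun Λ := (Λ.1, fun k => Λ.2 k + Λ.1 k * P k)
  invFun Λ := (Λ.1, fun k => Λ.2 k - Λ.1 k * P k)
  left_inv Λ := by simp
  right_inv Λ := by simp

/-- Broadcasting the data modulo `Z` leaves user `k` an ambiguity in `Z₀`, both for its demands and
for their combinations by `P k`. -/
lemma ambiguity_mem {k : Type} [Field k] [Algebra k F] {Z Z₀ : Submodule k F}
    {Λ : Inst F K d m m'} {P : Fin K → Matrix (Fin m) (Fin m') F}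
    (hZ : ∀ (u : Fin K) i j, ∀ z ∈ Z, userMatrix (shear P Λ) u i j * z ∈ Z₀)
    {φ : (Fin d → F) →+ (Fin d → F ⧸ Z)} (hφ : ∀ x i, φ x i = Z.mkQ (x i))
    {u : Fin K} {y : Fin m → F} (hy : y ∈ ambiguity φ Λ u) :
    (∀ i, y i ∈ Z₀) ∧ ∀ j, Matrix.vecMul y (P u) j ∈ Z₀ := by
  obtain ⟨x, h1, h2, rfl⟩ := mem_ambiguity.mp hy
  have hx : ∀ i, x i ∈ Z := by
    intro i
    have := congrFun h1 i
    rw [hφ] at this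
    simpa using this
  have h3 : ∀ j, Matrix.vecMul x (userMatrix (shear P Λ) u) j ∈ Z₀ := by
    intro j
    rw [Matrix.vecMul, dotProduct]
    refine Submodule.sum_mem _ fun i _ => ?_
    rw [mul_comm]
    exact hZ u i j (x i) (hx i)
  refine ⟨fun i => h3 (Sum.inl i), fun j => ?_⟩
  have h4 : Matrix.vecMul (Matrix.vecMul x (Λ.v u)) (P u) =
      Matrix.vecMul x (Λ.v' u + Λ.v u * P u) := by
    rw [Matrix.vecMul_add, h2, zero_add, Matrix.vecMul_vecMul]
  rw [h4]
  exact h3 (Sum.inr j)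

lemma pr_forall_mem {ι α : Type*} [Fintype ι] [Finite α] (X : Set α) :
    pr (fun b : ι → α => ∀ j, b j ∈ X) =
      (Nat.card X : ℝ) ^ Fintype.card ι / (Nat.card α : ℝ) ^ Fintype.card ι := by
  unfold pr
  rw [Nat.card_congr (Equiv.subtypePiEquivPi (p := fun _ a => a ∈ X)), Nat.card_fun]
  simp [Nat.card_pi]

/-- For a random matrix `P`, few vectors `y` have all entries of `y` and of `y P` in `Z₀`. -/
lemma pr_le_card_restricted_le {k : Type} [Field k] [Finite k] [Algebra k F]
    [FiniteDimensional k F] (Z₀ : Submodule k F) {D₀ C : ℕ}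
    (hZ₀ : Module.finrank k Z₀ + D₀ = Module.finrank k F)
    (hC : m * Module.finrank k F ≤ (m + m') * D₀ + C) {T : ℝ} (hT : 0 < T) (u : Fin K) :
    pr (fun P : Fin K → Matrix (Fin m) (Fin m') F => T ≤ Nat.card {y : Fin m → F //
      (∀ i, y i ∈ Z₀) ∧ ∀ j, Matrix.vecMul y (P u) j ∈ Z₀}) ≤ (1 + (Nat.card k : ℝ) ^ C) / T := by
  have : Finite F := Module.finite_of_finite k
  have hk : (0 : ℝ) < Nat.card k := by exact_mod_cast Nat.card_pos
  refine (pr_le_card_le_of_le (fun (P : Fin K → Matrix (Fin m) (Fin m') F) (y : Fin m → F) =>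
    (∀ i, y i ∈ Z₀) ∧ ∀ j, Matrix.vecMul y (P u) j ∈ Z₀) 0 {y | ∀ i, y i ∈ Z₀}
    (pr_nonneg (fun b : Fin m' → F => ∀ j, b j ∈ (Z₀ : Set F))) hT (fun _ _ h => h.1) ?_).trans ?_
  · intro y _ hy
    refine (pr_mono fun P h => h.2).trans (le_of_eq ?_)
    exact (pr_hom (Pi.evalAddMonoidHom (fun _ : Fin K => Matrix (Fin m) (Fin m') F) u)
      (Function.surjective_eval u) fun M => ∀ j, Matrix.vecMul y M j ∈ Z₀).trans
      (pr_vecMul hy fun b => ∀ j, b j ∈ Z₀)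
  · gcongr
    have h1 : (Nat.card ({y | ∀ i, y i ∈ Z₀} : Set (Fin m → F)) : ℝ) =
        (Nat.card Z₀ : ℝ) ^ m := by
      have := Nat.card_congr
        (Equiv.subtypePiEquivPi (p := fun (_ : Fin m) (a : F) => a ∈ Z₀))
      rw [Nat.card_pi] at this
      change (Nat.card {y : Fin m → F // ∀ i, y i ∈ Z₀} : ℝ) = _
      rw [this]
      simp
    rw [h1, pr_forall_mem]
    change (Nat.card Z₀ : ℝ) ^ m * ((Nat.card Z₀ : ℝ) ^ _ / _) ≤ _
    rw [Fintype.card_fin, Module.natCard_eq_pow_finrank (K := k) (V := Z₀),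
      Module.natCard_eq_pow_finrank (K := k) (V := F), mul_div_assoc', ← pow_add]
    push_cast
    -- With `n = finrank k F`, the exponent to bound is `(m + m') (n - D₀) - m' n = m n - (m + m')
    -- D₀ ≤ C`.
    rw [div_le_iff₀ (by positivity), ← pow_mul, ← pow_mul, ← pow_add]
    refine pow_le_pow_right₀ (by exact_mod_cast Finite.one_lt_card.le) ?_
    nlinarith

/-- For a random instance, aligned broadcasts nearly suffice. -/
lemma pr_aligned_lt_optCost_le {k : Type} [Field k] [Finite k] [Algebra k F]
    [FiniteDimensional k F] {ε δ : ℝ} {N : ℕ} (hε : 0 < ε) (hs : 0 < m + m')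
    (hN : ((N + 1 : ℕ) : ℝ) ^ Fintype.card (Fin K × Fin d × (Fin m ⊕ Fin m')) < (1 + ε) ^ N) :
    pr (fun Λ : Inst F K d m m' =>
      (d : ℝ) * ((1 + ε) * (m / (m + m'))) + K * δ < optCost Λ) ≤
      K * (1 + (Nat.card k : ℝ) ^
        ((m + m') * (1 + N ^ Fintype.card (Fin K × Fin d × (Fin m ⊕ Fin m'))))) /
        (Nat.card F : ℝ) ^ δ := by
  have : Finite F := Module.finite_of_finite k
  set T := Fintype.card (Fin K × Fin d × (Fin m ⊕ Fin m')) with hTdef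
  set n := Module.finrank k F with hn
  have hn0 : 0 < n := Module.finrank_pos
  -- This codimension balances cost and ambiguity: it is the largest `D` with `(m + m') D ≤ m n`,
  -- and rounding down costs less than `m + m'` in this inequality.
  set D := m * n / (m + m') with hD
  have hD1 : D * (m + m') ≤ m * n := Nat.div_mul_le_self _ _
  have hD2 : m * n < D * (m + m') + (m + m') := Nat.lt_div_mul_add hs
  have hDn : D ≤ n := by
    refine Nat.div_le_of_le_mul ?_
    exact Nat.mul_le_mul_right n (Nat.le_add_right m m')
  have hq : (1 : ℝ) < Nat.card F := by exact_mod_cast Finite.one_lt_card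
  have hT : (0 : ℝ) < (Nat.card F : ℝ) ^ δ := Real.rpow_pos_of_pos (by linarith) δ
  choose Z Z₀ D₀ hD₀ hDD₀ hZ₀ hZ hmul using fun Λ : Inst F K d m m' =>
    exists_aligned (k := k) (fun a : Fin K × Fin d × (Fin m ⊕ Fin m') =>
      userMatrix Λ a.1 a.2.1 a.2.2) hε hN hDn
  -- The spaces are chosen from the sheared instance. It can be held fixed while `P` varies, so the
  -- count over `P` sees a fixed `Z₀`.
  refine pr_le_of_forall (β := Fin K → Matrix (Fin m) (Fin m') F) shear
    (fun Λ P => ∃ u, (Nat.card F : ℝ) ^ δ ≤ Nat.card {y : Fin m → F //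
      (∀ i, y i ∈ Z₀ Λ) ∧ ∀ j, Matrix.vecMul y (P u) j ∈ Z₀ Λ}) _ ?_ ?_
  · intro Λ hΛ P
    by_contra hcon
    push Not at hcon
    have : Finite (F ⧸ Z (shear P Λ)) := Finite.of_surjective _ (Submodule.mkQ_surjective _)
    let φ : (Fin d → F) →+ (Fin d → F ⧸ Z (shear P Λ)) :=
      { toFun := fun x i => (Z (shear P Λ)).mkQ (x i)
        map_zero' := by funext i; simp
        map_add' := fun x y => by funext i; simp }
    refine absurd (optCost_le_of_ambiguity φ Λ (δ := δ) fun u => ?_) (not_le.mpr ?_)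
    · refine le_trans ?_ (hcon u).le
      have := Nat.card_le_card_of_injective
        (fun y : ambiguity φ Λ u => (⟨y.1, ambiguity_mem
          (fun u i j z hz => hmul (shear P Λ) (u, i, j) z hz) (fun _ _ => rfl) y.2⟩ :
          {y : Fin m → F // (∀ i, y i ∈ Z₀ (shear P Λ)) ∧
            ∀ j, Matrix.vecMul y (P u) j ∈ Z₀ (shear P Λ)}))
        (fun a b h => Subtype.ext (congrArg (fun z => z.1) h))
      exact_mod_cast this
    · refine lt_of_le_of_lt ?_ hΛ
      gcongr
      have hk : (1 : ℝ) < Nat.card k := by exact_mod_cast Finite.one_lt_card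
      have h1 : Real.logb (Nat.card F) (Nat.card (Fin d → F ⧸ Z (shear P Λ))) =
          d * (Module.finrank k (F ⧸ Z (shear P Λ)) / n) := by
        rw [Nat.card_fun, Nat.cast_pow, Real.logb_pow]
        rw [Module.natCard_eq_pow_finrank (K := k) (V := F),
          Module.natCard_eq_pow_finrank (K := k) (V := F ⧸ Z (shear P Λ)), Real.logb]
        push_cast
        rw [Real.log_pow, Real.log_pow, mul_div_mul_right _ _ (Real.log_pos hk).ne']
        simp [hn]
      rw [h1]
      have hn' : (0 : ℝ) < n := by exact_mod_cast hn0
      have hs' : (0 : ℝ) < (m : ℝ) + m' := by exact_mod_cast hs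
      gcongr
      have h2 : (Module.finrank k (F ⧸ Z (shear P Λ)) : ℝ) +
          Module.finrank k (Z (shear P Λ)) = n := by
        exact_mod_cast Submodule.finrank_quotient_add_finrank (Z (shear P Λ))
      have h3 := hZ (shear P Λ)
      have h4 : (D₀ (shear P Λ) : ℝ) * (m + m') ≤ m * n := by
        exact_mod_cast (Nat.mul_le_mul_right _ (hD₀ (shear P Λ))).trans hD1
      rw [div_le_iff₀ hn']
      have h5 : (D₀ (shear P Λ) : ℝ) ≤ m / (m + m') * n := by
        rw [div_mul_eq_mul_div, le_div_iff₀ hs']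
        exact h4
      nlinarith
  · intro Λ
    refine (pr_exists_le _).trans ((Finset.sum_le_sum fun u _ =>
      pr_le_card_restricted_le (Z₀ Λ) (C := (m + m') * (1 + N ^ T)) (hZ₀ Λ) ?_ hT u).trans
      (le_of_eq ?_))
    · have := Nat.mul_le_mul_right (m + m') (hDD₀ Λ)
      nlinarith
    · simp
      ring

end RandomAlignment

/-! ### Convergence in probability in the three regimes -/

section GenericCost

instance finite_galoisField (p : ℕ) [Fact p.Prime] (n : ℕ) : Finite (GaloisField p n) :=
  Module.finite_of_finite (ZMod p)

lemma tendsto_pr_of_le {p : ℕ} [Fact p.Prime] {K d m m' : ℕ}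
    {E : ∀ n, Inst (GaloisField p n) K d m m' → Prop} {C δ : ℝ} (hδ : 0 < δ)
    (h : ∀ n, pr (E n) ≤ C / (Nat.card (GaloisField p n) : ℝ) ^ δ) :
    Tendsto (fun n => pr (E n)) atTop (𝓝 0) := by
  have hp : (1 : ℝ) < p := by exact_mod_cast (Fact.out : p.Prime).one_lt
  have h1 : Tendsto (fun n : ℕ => ((p : ℝ) ^ n) ^ δ) atTop atTop :=
    (tendsto_rpow_atTop hδ).comp (tendsto_pow_atTop_atTop_of_one_lt hp)
  refine tendsto_of_tendsto_of_tendsto_of_le_of_le' tendsto_const_nhds (h1.const_div_atTop C)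
    (Eventually.of_forall fun n => pr_nonneg _) ?_
  -- The formula `p ^ n` for the cardinality requires `n ≠ 0`.
  filter_upwards [eventually_ne_atTop 0] with n hn
  have := h n
  rwa [GaloisField.card p n hn, Nat.cast_pow] at this

lemma isGenericCost_of_le {p : ℕ} [Fact p.Prime] {K d m m' : ℕ} {Δ : ℝ}
    (hup : ∀ ε : ℝ, 0 < ε → ∃ C δ : ℝ, 0 < δ ∧ ∀ n,
      pr (fun Λ : Inst (GaloisField p n) K d m m' => Δ + ε ≤ optCost Λ) ≤
        C / (Nat.card (GaloisField p n) : ℝ) ^ δ)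
    (hlow : ∃ C : ℝ, ∀ n, pr (fun Λ : Inst (GaloisField p n) K d m m' => optCost Λ < Δ) ≤
      C / (Nat.card (GaloisField p n) : ℝ)) :
    IsGenericCost p K d m m' Δ := by
  intro ε hε
  obtain ⟨C₁, δ, hδ, h1⟩ := hup ε hε
  obtain ⟨C₂, h2⟩ := hlow
  have t1 := tendsto_pr_of_le hδ h1
  have t2 := tendsto_pr_of_le (C := C₂) one_pos fun n => by
    rw [Real.rpow_one]
    exact h2 n
  have t3 := (t1.add t2).const_sub 1
  rw [add_zero, sub_zero] at t3
  simp only [prob_eq_pr]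
  refine tendsto_of_tendsto_of_tendsto_of_le_of_le t3 tendsto_const_nhds ?_ fun n => pr_le_one _
  intro n
  have h3 := pr_not fun Λ : Inst (GaloisField p n) K d m m' => |optCost Λ - Δ| < ε
  have h4 : pr (fun Λ : Inst (GaloisField p n) K d m m' => ¬ |optCost Λ - Δ| < ε) ≤ _ :=
    (pr_mono fun Λ h => ?_).trans
      (pr_or_le (fun Λ : Inst (GaloisField p n) K d m m' => Δ + ε ≤ optCost Λ)
        fun Λ => optCost Λ < Δ)
  · simp only
    linarith
  · by_contra hcon
    push Not at hcon
    exact h (abs_lt.mpr ⟨by linarith, by linarith⟩)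

lemma optCost_nonneg {F : Type} [Field F] [Finite F] {K d m m' : ℕ} (Λ : Inst F K d m m') :
    0 ≤ optCost Λ :=
  le_optCost fun σ _ => σ.cost_nonneg

lemma exists_pr_sub_add_le_optCost_le (p : ℕ) [Fact p.Prime] (K d m m' : ℕ) {ε : ℝ}
    (hε : 0 < ε) : ∃ C δ : ℝ, 0 < δ ∧ ∀ n,
      pr (fun Λ : Inst (GaloisField p n) K d m m' => ((d - m' : ℕ) : ℝ) + ε ≤ optCost Λ) ≤
        C / (Nat.card (GaloisField p n) : ℝ) ^ δ := by
  -- `K + 1` makes `K δ < ε` and also admits `K = 0`.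
  refine ⟨K * 2, ε / (K + 1), by positivity, fun n => ?_⟩
  refine (pr_mono fun Λ h => lt_of_lt_of_le ?_ h).trans
    (pr_sub_lt_optCost_le (δ := ε / (K + 1)))
  gcongr
  rw [mul_div_assoc', div_lt_iff₀ (by positivity)]
  linarith

lemma isGenericCost_zero (p : ℕ) [Fact p.Prime] {K d m m' : ℕ} (hd : d ≤ m') :
    IsGenericCost p K d m m' 0 := by
  refine isGenericCost_of_le (fun ε hε => ?_) ⟨0, fun n => ?_⟩
  · have := exists_pr_sub_add_le_optCost_le p K d m m' hε
    rwa [Nat.sub_eq_zero_of_le hd, Nat.cast_zero] at this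
  · rw [zero_div]
    have : ∀ Λ : Inst (GaloisField p n) K d m m', ¬ optCost Λ < 0 :=
      fun Λ => not_lt.mpr (optCost_nonneg Λ)
    simp [pr, this]

lemma isGenericCost_sub (p : ℕ) [Fact p.Prime] {K d m m' : ℕ} (hK : 0 < d → 0 < K)
    (hd : m' ≤ d) (hd' : d ≤ m + m') : IsGenericCost p K d m m' ((d : ℝ) - m') := by
  rcases Nat.eq_zero_or_pos d with rfl | hd0
  · obtain rfl : m' = 0 := by omega
    simpa using isGenericCost_zero p (K := K) (m := m) (le_refl 0)
  · refine isGenericCost_of_le (fun ε hε => ?_) ⟨2, fun n => ?_⟩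
    · have := exists_pr_sub_add_le_optCost_le p K d m m' hε
      rwa [Nat.cast_sub hd] at this
    · refine (pr_mono fun Λ h => ?_).trans (pr_userSpace_ne_top_le ⟨0, hK hd0⟩ hd')
      intro htop
      exact absurd (le_optCost fun σ hσ => Scheme.le_cost_of_userSpace_eq_top hσ htop) (not_le.mpr h)

lemma isGenericCost_aligned (p : ℕ) [Fact p.Prime] {K d m m' : ℕ}
    (hK : d / Nat.gcd d (m + m') ≤ K) (hs : 0 < m + m') (hd : m + m' < d) :
    IsGenericCost p K d m m' ((d : ℝ) * m / (m + m')) := by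
  have hs' : (0 : ℝ) < (m : ℝ) + m' := by exact_mod_cast hs
  refine isGenericCost_of_le (fun ε hε => ?_)
    ⟨(d / Nat.gcd d (m + m') : ℕ) * 4, fun n => ?_⟩
  · have hε' : 0 < ε / (2 * (d + 1)) := by positivity
    obtain ⟨N, hN⟩ := exists_pow_lt (Fintype.card (Fin K × Fin d × (Fin m ⊕ Fin m'))) hε'
    -- The alignment loss and the residues each take less than `ε / 2`. The constant left to
    -- unification involves `p` and `N` but not `n`, because `N` was fixed beforehand.
    refine ⟨_, ε / (2 * (K + 1)), by positivity, fun n => (pr_mono fun Λ h => lt_of_lt_of_le ?_ h).trans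
      (pr_aligned_lt_optCost_le (k := ZMod p) (δ := ε / (2 * (K + 1))) hε' hs hN)⟩
    have h1 : (m : ℝ) / (m + m') ≤ 1 := by
      refine div_le_one_of_le₀ ?_ hs'.le
      linarith [Nat.cast_nonneg (α := ℝ) m']
    have h2 : (d : ℝ) * (ε / (2 * (d + 1))) < ε / 2 := by
      rw [mul_div_assoc', div_lt_div_iff₀ (by positivity) (by positivity)]
      nlinarith
    have h3 : (K : ℝ) * (ε / (2 * (K + 1))) < ε / 2 := by
      rw [mul_div_assoc', div_lt_div_iff₀ (by positivity) (by positivity)]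
      nlinarith
    have h4 : (d : ℝ) * (ε / (2 * (d + 1))) * (m / (m + m')) ≤ d * (ε / (2 * (d + 1))) :=
      mul_le_of_le_one_right (by positivity) h1
    rw [mul_div_assoc]
    linarith
  -- `N = d / g` and `t = (m + m') / g` are the smallest positive solution of `N (m + m') = t d`;
  -- the hypothesis on `K` supplies these `N` users.
  · set g := Nat.gcd d (m + m') with hg
    have hg0 : 0 < g := Nat.gcd_pos_of_pos_right _ hs
    have hdg : d / g * g = d := Nat.div_mul_cancel (Nat.gcd_dvd_left _ _)
    have hsg : (m + m') / g * g = m + m' := Nat.div_mul_cancel (Nat.gcd_dvd_right _ _)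
    have ht : 0 < (m + m') / g := Nat.div_pos (Nat.le_of_dvd hs (Nat.gcd_dvd_right _ _)) hg0
    have hN : d / g * (m + m') = (m + m') / g * d := by
      calc d / g * (m + m') = d / g * ((m + m') / g * g) := by rw [hsg]
        _ = (m + m') / g * (d / g * g) := by ring
        _ = _ := by rw [hdg]
    refine (pr_mono fun Λ h => ?_).trans ((pr_not_inGeneralPosition_le hK hd.le).trans
      (le_of_eq (mul_div_assoc _ _ _).symm))
    intro hpos
    refine absurd (le_optCost fun σ hσ => ?_) (not_le.mpr h)
    have h1 := Scheme.le_cost_of_inGeneralPosition hσ hK (by omega) ht hN hpos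
    refine le_of_eq_of_le ?_ h1
    have hN' : ((d / g : ℕ) : ℝ) * (m + m') = ((m + m') / g : ℕ) * d := by exact_mod_cast hN
    have ht' : (((m + m') / g : ℕ) : ℝ) ≠ 0 := by exact_mod_cast ht.ne'
    rw [div_eq_div_iff hs'.ne' ht']
    linear_combination (-(m : ℝ)) * hN'

end GenericCost

end LCBC

theorem theorem2 (p : ℕ) [Fact p.Prime] (K d m m' : ℕ)
    (hK : d / Nat.gcd d (m + m') ≤ K) :
    (d ≤ m' → LCBC.IsGenericCost p K d m m' 0) ∧
    (m' ≤ d → d ≤ m + m' → LCBC.IsGenericCost p K d m m' ((d : ℝ) - (m' : ℝ))) ∧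
    (m + m' < d → d ≤ K * (m + m') →
      LCBC.IsGenericCost p K d m m' ((d : ℝ) * (m : ℝ) / ((m : ℝ) + (m' : ℝ)))) := by
  refine ⟨LCBC.isGenericCost_zero p, LCBC.isGenericCost_sub p fun hd => ?_, fun hd hdK => ?_⟩
  · exact (Nat.div_pos (Nat.gcd_le_left _ hd) (Nat.gcd_pos_of_pos_left _ hd)).trans_le hK
  · refine LCBC.isGenericCost_aligned p hK ?_ hd
    -- If `m + m' = 0`, then `d ≤ K (m + m')` forces `d = 0`, against `m + m' < d`.
    by_contra h
    rw [Nat.eq_zero_of_not_pos h] at hd hdK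
    omega
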